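/- Let $N\ge 2$, $\alpha,\beta\in\mathbb R$, $V\in\mathbb R^N$, $P(t)=t^4-\beta t^2+\alpha$, $F(\xi)=P(|\xi|)-\xi\cdot V$ and $M=\{\xi\in\mathbb R^N: F(\xi)=0\}$. Assume (A1) $F(\tilde\xi)<0$ for some $\tilde\xi\in\mathbb R^N$; (A2) $P'(|\xi|)\frac{\xi}{|\xi|}-V\neq0$ for all $\xi\in M$ (the first term is read as $0$ at $\xi=0$); (A3) $P(|\xi|)-|V||\xi|\ne0$ for every $\xi\in\mathbb R^N$ with $P'(|\xi|)=0$. For $\varepsilon>0$ let $G_\varepsilon(x)=(2\pi)^{-N}\int_{\mathbb R^N}\frac{e^{ix\cdot\xi}}{F(\xi)-i\varepsilon}\,d\xi$ (as a tempered distribution) be the Green function of $\Delta^2+\beta\Delta+iV\cdot\nabla+\alpha-i\varepsilon$. Then the limit $G=\lim_{\varepsilon\to0^+}G_\varepsilon$ exists in the space of tempered distributions on $\mathbb R^N$. Moreover, let $c_1>0$ and let $\psi\in\mathcal S(\mathbb R^N)$ be such that $\hat\psi(\xi)=\int_{\mathbb R^N} e^{-ix\cdot\xi}\psi(x)\,dx$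 satisfies $\hat\psi\in C_c^\infty(\mathbb R^N)$, $0\le\hat\psi\le1$, $\hat\psi(\xi)=1$ if $\operatorname{dist}(\xi,M)\le c_1$ and $\hat\psi(\xi)=0$ if $\operatorname{dist}(\xi,M)\ge 2c_1$. Put $G_1=G-\psi*G$ and, for $f\in\mathcal S(\mathbb R^N)$, $\mathfrak R_1f=G_1*f$. Then for all $p,q\in(1,\infty)$ with $q>p$ and $$\frac1p-\frac1q\ \begin{cases}\le 1&\text{if }N<4,\\ <1&\text{if }N=4,\\ \le \frac4N&\text{if }N>4,\end{cases}$$ the operator $\mathfrak R_1$ extends to a bounded linear operator from $L^p(\mathbb R^N)$ to $L^q(\mathbb R^N)$ (of complex-valued functions); that is, the extension, again denoted $\mathfrak R_1$, satisfies $\|\mathfrak R_1f\|_{L^q(\mathbb R^N)}\le C\|f\|_{L^p(\mathbb R^N)}$ for all $f\in L^p(\mathbb R^N)$, with a constant $C$ independent of $f$. -/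

import Mathlib

open MeasureTheory Filter Topology
open scoped SchwartzMap ENNReal ContDiff

namespace Helmholtz

noncomputable section

/-- The even quartic polynomial `P(t) = t⁴ - β t² + α`. -/
def profile (α β : ℝ) (t : ℝ) : ℝ := t ^ 4 - β * t ^ 2 + α

variable {N : ℕ}

/-- The Fourier symbol `F(ξ) = P(|ξ|) - ξ · V` of `Δ² + βΔ + iV·∇ + α` on `ℝᴺ`, where
plane waves are `exp(i x · ξ)`. -/
def symbol (α β : ℝ) (V ξ : EuclideanSpace ℝ (Fin N)) : ℝ :=
  profile α β ‖ξ‖ - inner ℝ ξ V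

/-- The characteristic set `M = {ξ : F(ξ) = 0}`. -/
def charSet (α β : ℝ) (V : EuclideanSpace ℝ (Fin N)) : Set (EuclideanSpace ℝ (Fin N)) :=
  {ξ | symbol α β V ξ = 0}

/-- (A1): the symbol is negative somewhere. -/
def CondA1 (α β : ℝ) (V : EuclideanSpace ℝ (Fin N)) : Prop :=
  ∃ ξ : EuclideanSpace ℝ (Fin N), symbol α β V ξ < 0

/-- (A2): `P'(|ξ|) ξ/|ξ| - V ≠ 0` on `M`. At `ξ = 0` the first term is `0`, in accordance with
`P'(0) = 0`, so that the left-hand side is `∇F(ξ)` for every `ξ`. -/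
def CondA2 (α β : ℝ) (V : EuclideanSpace ℝ (Fin N)) : Prop :=
  ∀ ξ ∈ charSet α β V, deriv (profile α β) ‖ξ‖ • (‖ξ‖⁻¹ • ξ) - V ≠ 0

/-- (A3): `P(|ξ|) ≠ |V||ξ|` wherever `P'(|ξ|) = 0`. -/
def CondA3 (α β : ℝ) (V : EuclideanSpace ℝ (Fin N)) : Prop :=
  ∀ ξ : EuclideanSpace ℝ (Fin N), deriv (profile α β) ‖ξ‖ = 0 →
    profile α β ‖ξ‖ - ‖V‖ * ‖ξ‖ ≠ 0

/-- The Fourier transform `f̂(ξ) = ∫ exp(-i x · ξ) f(x) dx`; with this normalization convolution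
with `f` is multiplication by `f̂` on the Fourier side. -/
def hat (f : EuclideanSpace ℝ (Fin N) → ℂ) (ξ : EuclideanSpace ℝ (Fin N)) : ℂ :=
  ∫ x, Complex.exp (-(Complex.I * (inner ℝ x ξ : ℝ))) * f x

/-- The action on a test function `φ` of the approximate Green function
`G_ε(x) = (2π)⁻ᴺ ∫ exp(i x · ξ) / (F(ξ) - iε) dξ`, the tempered fundamental solution of
`Δ² + βΔ + iV·∇ + (α - iε)`, `ε ≠ 0`. -/
def approxGreen (α β : ℝ) (V : EuclideanSpace ℝ (Fin N)) (ε : ℝ)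
    (φ : 𝓢(EuclideanSpace ℝ (Fin N), ℂ)) : ℂ :=
  ((2 * Real.pi) ^ N : ℝ)⁻¹ *
    ∫ ξ : EuclideanSpace ℝ (Fin N),
      (∫ x : EuclideanSpace ℝ (Fin N), Complex.exp (Complex.I * (inner ℝ x ξ : ℝ)) * φ x) /
        ((symbol α β V ξ : ℝ) - Complex.I * (ε : ℝ))

/-- `G` is the outgoing Green function given by limiting absorption: `G = lim G_ε` as `ε → 0⁺`,
in the sense of tempered distributions. -/
def IsGreenFunction (α β : ℝ) (V : EuclideanSpace ℝ (Fin N))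
    (G : 𝓢'(EuclideanSpace ℝ (Fin N), ℂ)) : Prop :=
  ∀ φ : 𝓢(EuclideanSpace ℝ (Fin N), ℂ),
    Tendsto (fun ε : ℝ => approxGreen α β V ε φ) (𝓝[>] 0) (𝓝 (G φ))

/-- `ψ̂` is a smooth compactly supported cut-off with values in `[0, 1]`, equal to `1` at distance
at most `c₁` from `M` and to `0` at distance at least `2c₁`. -/
structure IsCutoff (α β : ℝ) (V : EuclideanSpace ℝ (Fin N)) (c₁ : ℝ)
    (ψ : 𝓢(EuclideanSpace ℝ (Fin N), ℂ)) : Prop where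
  smooth : ContDiff ℝ ∞ (hat (fun x => ψ x))
  compact_support : HasCompactSupport (hat (fun x => ψ x))
  mem_unit : ∀ ξ, ∃ r : ℝ, 0 ≤ r ∧ r ≤ 1 ∧ hat (fun x => ψ x) ξ = (r : ℂ)
  eq_one : ∀ ξ, Metric.infDist ξ (charSet α β V) ≤ c₁ → hat (fun x => ψ x) ξ = 1
  eq_zero : ∀ ξ, 2 * c₁ ≤ Metric.infDist ξ (charSet α β V) → hat (fun x => ψ x) ξ = 0

/-- The Schwartz function `y ↦ f (x - y)`. -/
def reflectAt (f : 𝓢(EuclideanSpace ℝ (Fin N), ℂ)) (x : EuclideanSpace ℝ (Fin N)) :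
    𝓢(EuclideanSpace ℝ (Fin N), ℂ) :=
  SchwartzMap.compSubConstCLM ℂ x
    (SchwartzMap.compCLMOfContinuousLinearEquiv ℂ
      (ContinuousLinearEquiv.neg ℝ (M := EuclideanSpace ℝ (Fin N))) f)

theorem reflectAt_apply (f : 𝓢(EuclideanSpace ℝ (Fin N), ℂ)) (x y : EuclideanSpace ℝ (Fin N)) :
    reflectAt f x y = f (x - y) := by
  simp [reflectAt]

/-- The near-singular part `G₂ = ψ * G`, the function `x ↦ ⟨G, ψ(x - ·)⟩`. -/
def greenNear (G : 𝓢'(EuclideanSpace ℝ (Fin N), ℂ)) (ψ : 𝓢(EuclideanSpace ℝ (Fin N), ℂ))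
    (x : EuclideanSpace ℝ (Fin N)) : ℂ :=
  G (reflectAt ψ x)

/-- The action on test functions of `G₁ = (1 - ψ) * G = G - ψ * G` (here `1` is the unit of
convolution, the Dirac mass at the origin, so that `Ĝ₁ = (1 - ψ̂) Ĝ`). -/
def greenAway (G : 𝓢'(EuclideanSpace ℝ (Fin N), ℂ)) (ψ : 𝓢(EuclideanSpace ℝ (Fin N), ℂ))
    (φ : 𝓢(EuclideanSpace ℝ (Fin N), ℂ)) : ℂ :=
  G φ - ∫ y, greenNear G ψ y * φ y

/-- The operator `R₁ f = G₁ * f` on Schwartz functions: `(G₁ * f)(x) = ⟨G₁, f(x - ·)⟩`. -/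
def resolventAway (G : 𝓢'(EuclideanSpace ℝ (Fin N), ℂ)) (ψ f : 𝓢(EuclideanSpace ℝ (Fin N), ℂ))
    (x : EuclideanSpace ℝ (Fin N)) : ℂ :=
  greenAway G ψ (reflectAt f x)

end

end Helmholtz

/-! Existence of `G`. By (A2), `F² + |∇F|²` has no zero, so `X = ∇F / (F² + |∇F|²)` and `b = F / (F²
+ |∇F|²)` are smooth of temperate growth and `X · ∇F + b F = 1`. Inserting this identity into `∫ g
H'(F - iε)` and integrating by parts replaces `H'` by its primitive `H`, at the cost of a term
carrying the factor `F`. Two rounds turn `1/z` into `log z` and then into `z log z - z`. The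
integrands left over contain `F / z`, `F log z` or `z log z - z` at `z = F - iε`. All are
polynomially bounded uniformly in `ε` and converge pointwise, so the integrals converge and are
dominated by one continuous seminorm (`exists_tendsto_integral_div_below`). The limit is therefore a
tempered distribution.

Boundedness of the operator. At fixed `ε` Fubini applies, and letting `ε → 0` shows that convolution
with `G₁` is the Fourier multiplier `m = (1 - ψ̂) / F` (`resolventAway_eq`). The numerator vanishes
near the zero set and `F` grows like `|ξ|⁴`, so `m` is a smooth symbol of order `-4`
(`isSymbol_awayMultiplier`). Such a symbol obeys the derivative bounds of a function homogeneous of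
degree `-a` for every `0 ≤ a ≤ 4`. For `0 < a < N`, splitting frequencies at `|ξ| ~ 1/|x|` then
bounds the kernel by a multiple of `|x|^(a - N)` (`exists_fourier_le_of_homogeneousBound`). The
operator is thus dominated pointwise by a Riesz potential. With `a = N(1/p - 1/q)` the
Hardy–Littlewood–Sobolev inequality gives the bound from `Lᵖ` to `Lᵠ`: the dimensional conditions
yield `a ≤ 4`, while `p > 1` and `q < ∞` yield `a < N`. Density of Schwartz functions finishes the
proof. -/

namespace Helmholtz

open Asymptotics

/-! ### Symbol classes at infinity. -/

section Symbols

variable {E A : Type*} [NormedAddCommGroup E] [NormedAddCommGroup A]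

theorem eventually_cocompact_le_norm [ProperSpace E] (R : ℝ) : ∀ᶠ ξ in cocompact E, R ≤ ‖ξ‖ :=
  (tendsto_norm_cocompact_atTop (E := E)).eventually_ge_atTop R

/-- Derivatives depend on germs, so identities near infinity must hold in a neighbourhood of each
far point before they can be differentiated. -/
theorem eventually_cocompact_nhds [ProperSpace E] {P : E → Prop} (h : ∀ᶠ ξ in cocompact E, P ξ) :
    ∀ᶠ ξ in cocompact E, ∀ᶠ η in 𝓝 ξ, P η := by
  rw [← Metric.cobounded_eq_cocompact,
    (Metric.hasBasis_cobounded_compl_closedBall (0 : E)).eventually_iff] at h ⊢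
  obtain ⟨r, -, hr⟩ := h
  refine ⟨r, trivial, fun ξ hξ => ?_⟩
  filter_upwards [(Metric.isClosed_closedBall.isOpen_compl).mem_nhds hξ] with η hη using hr hη

theorem isBigO_norm_rpow_of_le [ProperSpace E] {s t : ℝ} (h : s ≤ t) :
    (fun ξ : E => ‖ξ‖ ^ s) =O[cocompact E] fun ξ => ‖ξ‖ ^ t := by
  refine IsBigO.of_bound 1 ?_
  filter_upwards [eventually_cocompact_le_norm (E := E) 1] with ξ hξ
  rw [Real.norm_of_nonneg (by positivity), Real.norm_of_nonneg (by positivity), one_mul]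
  exact Real.rpow_le_rpow_of_exponent_le hξ h

theorem norm_rpow_mul_eventuallyEq [ProperSpace E] (s t : ℝ) :
    (fun ξ : E => ‖ξ‖ ^ s * ‖ξ‖ ^ t) =ᶠ[cocompact E] fun ξ => ‖ξ‖ ^ (s + t) := by
  filter_upwards [eventually_cocompact_le_norm (E := E) 1] with ξ hξ
  rw [Real.rpow_add (by linarith)]

variable [NormedSpace ℝ E] [NormedSpace ℝ A]

/-- The derivatives of `f` up to order `n` decay at infinity like those of a symbol of order `s`. -/
def SymbolBound (n : ℕ) (s : ℝ) (f : E → A) : Prop :=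
  ∀ k ≤ n, iteratedFDeriv ℝ k f =O[cocompact E] fun ξ => ‖ξ‖ ^ (s - k)

namespace SymbolBound

theorem mono_right [ProperSpace E] {n : ℕ} {s t : ℝ} {f : E → A} (h : SymbolBound n s f)
    (hst : s ≤ t) : SymbolBound n t f :=
  fun k hk => (h k hk).trans (isBigO_norm_rpow_of_le (by linarith))

theorem mono_left {m n : ℕ} {s : ℝ} {f : E → A} (h : SymbolBound n s f)
    (hmn : m ≤ n) : SymbolBound m s f :=
  fun k hk => h k (hk.trans hmn)

theorem congr [ProperSpace E] {n : ℕ} {s : ℝ} {f g : E → A} (h : SymbolBound n s f)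
    (hfg : f =ᶠ[cocompact E] g) : SymbolBound n s g := by
  intro k hk
  refine (h k hk).congr' ?_ EventuallyEq.rfl
  filter_upwards [eventually_cocompact_nhds hfg] with ξ hξ
  exact (EventuallyEq.iteratedFDeriv ℝ hξ k).eq_of_nhds

theorem of_fderiv {n : ℕ} {s : ℝ} {f : E → A} (h0 : f =O[cocompact E] fun ξ => ‖ξ‖ ^ s)
    (h : SymbolBound n (s - 1) (fderiv ℝ f)) : SymbolBound (n + 1) s f := by
  intro k hk
  rcases k with _ | k
  · refine IsBigO.of_norm_left ?_
    simpa only [norm_iteratedFDeriv_zero, Nat.cast_zero, sub_zero] using h0.norm_left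
  · refine IsBigO.of_norm_left ?_
    simp only [← norm_iteratedFDeriv_fderiv]
    refine (h k (by omega)).norm_left.congr_right fun ξ => ?_
    push_cast
    ring_nf

theorem fderiv {n : ℕ} {s : ℝ} {f : E → A} (h : SymbolBound (n + 1) s f) :
    SymbolBound n (s - 1) (_root_.fderiv ℝ f) := by
  intro k hk
  refine IsBigO.of_norm_left ?_
  simp only [norm_iteratedFDeriv_fderiv]
  refine (h (k + 1) (by omega)).norm_left.congr_right fun ξ => ?_
  push_cast
  ring_nf

theorem const (n : ℕ) (c : A) : SymbolBound n 0 fun _ : E => c := by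
  intro k _
  rcases Nat.eq_zero_or_pos k with rfl | hk
  · refine IsBigO.of_norm_left ?_
    simp only [norm_iteratedFDeriv_zero, Nat.cast_zero, sub_zero, Real.rpow_zero]
    exact isBigO_const_const _ one_ne_zero _
  · rw [iteratedFDeriv_const_of_ne hk.ne']
    exact isBigO_zero _ _

theorem clm (n : ℕ) (L : E →L[ℝ] A) : SymbolBound n 1 fun ξ => L ξ := by
  -- `of_fderiv` only produces bounds of order at least one, hence the detour through `n + 1`.
  suffices SymbolBound (n + 1) 1 fun ξ => L ξ from this.mono_left (by omega)
  refine of_fderiv ?_ ?_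
  · simpa using (L.isBigO_id (cocompact E)).norm_right
  · rw [show _root_.fderiv ℝ (fun ξ => L ξ) = fun _ => L from funext fun _ => L.fderiv, sub_self]
    exact const _ _

theorem add {n : ℕ} {s : ℝ} {f g : E → A} (hf : SymbolBound n s f) (hg : SymbolBound n s g)
    (hf' : ContDiff ℝ ∞ f) (hg' : ContDiff ℝ ∞ g) : SymbolBound n s fun ξ => f ξ + g ξ := by
  intro k hk
  refine ((hf k hk).add (hg k hk)).congr_left fun ξ => ?_
  exact (iteratedFDeriv_add_apply (hf'.contDiffAt.of_le (mod_cast le_top))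
    (hg'.contDiffAt.of_le (mod_cast le_top))).symm

theorem smul [ProperSpace E] [NormedSpace ℂ A] {n : ℕ} {s t : ℝ} {f : E → ℂ}
    {g : E → A} (hf : SymbolBound n s f) (hg : SymbolBound n t g) (hf' : ContDiff ℝ ∞ f)
    (hg' : ContDiff ℝ ∞ g) : SymbolBound n (s + t) fun ξ => f ξ • g ξ := by
  intro k hk
  refine (IsBigO.of_norm_le (g := fun ξ => ∑ i ∈ Finset.range (k + 1),
    (k.choose i : ℝ) * ‖iteratedFDeriv ℝ i f ξ‖ * ‖iteratedFDeriv ℝ (k - i) g ξ‖) fun ξ =>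
      norm_iteratedFDeriv_smul_le hf' hg' ξ (mod_cast le_top)).trans ?_
  refine IsBigO.fun_sum fun i hi => ?_
  have hik : i ≤ k := by simpa [Nat.lt_succ_iff] using hi
  have h := ((hf i (hik.trans hk)).norm_left.const_mul_left (k.choose i : ℝ)).mul
    (hg (k - i) ((Nat.sub_le _ _).trans hk)).norm_left
  refine h.trans_eventuallyEq ((norm_rpow_mul_eventuallyEq _ _).trans (Eventually.of_forall ?_))
  intro ξ
  simp only [Nat.cast_sub hik]
  ring_nf

theorem mul [ProperSpace E] {n : ℕ} {s t : ℝ} {f g : E → ℂ}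
    (hf : SymbolBound n s f) (hg : SymbolBound n t g) (hf' : ContDiff ℝ ∞ f)
    (hg' : ContDiff ℝ ∞ g) : SymbolBound n (s + t) fun ξ => f ξ * g ξ :=
  hf.smul hg hf' hg'

/-- The reciprocal near infinity of an elliptic symbol of order `s` is a symbol of order `-s`. -/
theorem inv [ProperSpace E] {s : ℝ} {f u : E → ℂ} (hf : ∀ n, SymbolBound n s f)
    (hf' : ContDiff ℝ ∞ f) (hu' : ContDiff ℝ ∞ u) (huf : ∀ᶠ ξ in cocompact E, u ξ * f ξ = 1)
    {c : ℝ} (hc : 0 < c) (hfc : ∀ᶠ ξ in cocompact E, c * ‖ξ‖ ^ s ≤ ‖f ξ‖) (n : ℕ) :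
    SymbolBound n (-s) u := by
  have h0 : u =O[cocompact E] fun ξ => ‖ξ‖ ^ (-s) := by
    refine IsBigO.of_bound c⁻¹ ?_
    filter_upwards [huf, hfc, eventually_cocompact_le_norm (E := E) 1] with ξ h1 h2 h3
    have hξ : 0 < ‖ξ‖ ^ s := Real.rpow_pos_of_pos (by linarith) _
    have h4 : ‖u ξ‖ * ‖f ξ‖ = 1 := by rw [← norm_mul, h1, norm_one]
    rw [Real.norm_of_nonneg (by positivity), Real.rpow_neg (norm_nonneg _), ← mul_inv]
    rw [eq_inv_of_mul_eq_one_left h4]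
    exact inv_anti₀ (by positivity) h2
  induction n with
  | zero =>
    intro k hk
    obtain rfl : k = 0 := by omega
    refine IsBigO.of_norm_left ?_
    simpa only [norm_iteratedFDeriv_zero, Nat.cast_zero, sub_zero] using h0.norm_left
  | succ n ih =>
    refine of_fderiv h0 ?_
    have hdf : ContDiff ℝ ∞ (_root_.fderiv ℝ f) := hf'.fderiv_right (by simp)
    have hu2 : ContDiff ℝ ∞ fun ξ => u ξ * u ξ := hu'.mul hu'
    -- Differentiating `u f = 1` gives `Du = -u² Df`, whose order is `-2s + (s - 1) = -s - 1`; only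
    -- bounds on `u` up to order `n` enter.
    have h1 : SymbolBound n (0 + ((-s + -s) + (s - 1)))
        fun ξ => (-1 : ℂ) • ((u ξ * u ξ) • _root_.fderiv ℝ f ξ) :=
      (const n (-1 : ℂ)).smul ((ih.mul ih hu' hu').smul (hf (n + 1)).fderiv hu2 hdf)
        contDiff_const (hu2.smul hdf)
    rw [show (0 + ((-s + -s) + (s - 1)) : ℝ) = -s - 1 by ring] at h1
    refine h1.congr ?_
    filter_upwards [eventually_cocompact_nhds huf] with ξ hξ
    have hd : HasFDerivAt (fun η => u η * f η)
        (u ξ • _root_.fderiv ℝ f ξ + f ξ • _root_.fderiv ℝ u ξ) ξ :=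
      (hu'.differentiable (by simp) ξ).hasFDerivAt.mul (hf'.differentiable (by simp) ξ).hasFDerivAt
    have h2 : u ξ • _root_.fderiv ℝ f ξ + f ξ • _root_.fderiv ℝ u ξ = 0 :=
      hd.unique ((hasFDerivAt_const (1 : ℂ) ξ).congr_of_eventuallyEq hξ)
    have h3 : u ξ * f ξ = 1 := hξ.self_of_nhds
    have h4 := congrArg (fun L => u ξ • L) h2
    simp only [smul_add, smul_smul, h3, one_smul] at h4
    have h5 : u ξ • (0 : E →L[ℝ] ℂ) = 0 := by ext; simp
    exact (neg_one_smul ℂ _).trans (eq_neg_of_add_eq_zero_right (h4.trans h5)).symm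

/-- A symbol bound together with continuity gives a bound on the whole space. -/
theorem exists_bound [ProperSpace E] {n : ℕ} {s : ℝ} {f : E → A}
    (hf : SymbolBound n s f) (hf' : ContDiff ℝ ∞ f) :
    ∃ C : ℝ, 0 ≤ C ∧ ∀ k ≤ n, ∀ ξ, ‖iteratedFDeriv ℝ k f ξ‖ ≤ C * (1 + ‖ξ‖) ^ (s - k) := by
  have key : ∀ k, ∃ C : ℝ, 0 ≤ C ∧
      (k ≤ n → ∀ ξ, ‖iteratedFDeriv ℝ k f ξ‖ ≤ C * (1 + ‖ξ‖) ^ (s - k)) := by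
    intro k
    by_cases hk : k ≤ n
    swap
    · exact ⟨0, le_rfl, fun h => absurd h hk⟩
    have hcont : Continuous (iteratedFDeriv ℝ k f) :=
      hf'.continuous_iteratedFDeriv (mod_cast le_top)
    obtain ⟨c, hc⟩ := (hf k hk).bound
    have hg : Continuous fun ξ : E => ‖iteratedFDeriv ℝ k f ξ‖ * ((1 + ‖ξ‖) ^ (s - k))⁻¹ := by
      refine hcont.norm.mul (Continuous.inv₀ ?_ fun ξ =>
        (Real.rpow_pos_of_pos (add_pos_of_pos_of_nonneg one_pos (norm_nonneg ξ)) _).ne')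
      exact (continuous_const.add continuous_norm).rpow_const fun ξ => Or.inl
        (add_pos_of_pos_of_nonneg one_pos (norm_nonneg ξ)).ne'
    -- For `‖ξ‖ ≥ 1` the weights `‖ξ‖` and `1 + ‖ξ‖` differ by a factor at most 2. The remaining
    -- points form a compact set, on which continuity suffices.
    have hev : ∀ᶠ ξ in cocompact E, ‖iteratedFDeriv ℝ k f ξ‖ * ((1 + ‖ξ‖) ^ (s - k))⁻¹ ≤
        |c| * 2 ^ |s - k| := by
      filter_upwards [hc, eventually_cocompact_le_norm (E := E) 1] with ξ h1 h2
      rw [Real.norm_of_nonneg (by positivity)] at h1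
      rw [← div_eq_mul_inv, div_le_iff₀ (by positivity)]
      have h3 : ‖ξ‖ ^ (s - k) ≤ 2 ^ |s - k| * (1 + ‖ξ‖) ^ (s - k) := by
        rcases le_total 0 (s - k) with h | h
        · calc ‖ξ‖ ^ (s - k) ≤ (1 + ‖ξ‖) ^ (s - k) :=
                Real.rpow_le_rpow (norm_nonneg _) (by linarith) h
            _ ≤ _ := le_mul_of_one_le_left (by positivity)
                (Real.one_le_rpow (by norm_num) (abs_nonneg _))
        · rw [abs_of_nonpos h, Real.rpow_neg (by norm_num), ← div_eq_inv_mul,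
            ← Real.div_rpow (by positivity) (by norm_num)]
          exact Real.rpow_le_rpow_of_nonpos (by linarith) (by linarith) h
      calc ‖iteratedFDeriv ℝ k f ξ‖ ≤ c * ‖ξ‖ ^ (s - k) := h1
        _ ≤ |c| * ‖ξ‖ ^ (s - k) := by gcongr; exact le_abs_self c
        _ ≤ |c| * (2 ^ |s - k| * (1 + ‖ξ‖) ^ (s - k)) := by gcongr
        _ = _ := by ring
    obtain ⟨K, hK, hKc⟩ := mem_cocompact.1 hev
    obtain ⟨M, hM⟩ := (hK.image hg).bddAbove
    refine ⟨max (|c| * 2 ^ |s - k|) M, le_max_of_le_left (by positivity), fun _ ξ => ?_⟩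
    rw [← div_le_iff₀ (by positivity), div_eq_mul_inv]
    by_cases hξ : ξ ∈ K
    · exact (hM ⟨ξ, hξ, rfl⟩).trans (le_max_right _ _)
    · exact (hKc hξ).trans (le_max_left _ _)
  choose C hC0 hC using key
  refine ⟨∑ k ∈ Finset.range (n + 1), C k, Finset.sum_nonneg fun k _ => hC0 k, fun k hk ξ => ?_⟩
  refine (hC k hk ξ).trans ?_
  gcongr
  exact Finset.single_le_sum (f := C) (fun i _ => hC0 i) (Finset.mem_range.2 (by omega))

theorem hasTemperateGrowth [ProperSpace E] {s : ℝ} {f : E → A} (hf : ∀ n, SymbolBound n s f)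
    (hf' : ContDiff ℝ ∞ f) : f.HasTemperateGrowth := by
  refine ⟨hf', fun n => ?_⟩
  obtain ⟨C, hC0, hC⟩ := (hf n).exists_bound hf'
  refine ⟨⌈|s|⌉₊, C, fun ξ => (hC n le_rfl ξ).trans ?_⟩
  gcongr
  rw [← Real.rpow_natCast]
  refine Real.rpow_le_rpow_of_exponent_le (by simp) ?_
  have := le_abs_self s
  have := Nat.le_ceil |s|
  have : (0 : ℝ) ≤ n := Nat.cast_nonneg n
  linarith

end SymbolBound

end Symbols

end Helmholtz
namespace Helmholtz

/-! ### Riesz potentials: distribution function and layer-cake estimates. -/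

section FractionalIntegration

variable {E : Type*} [NormedAddCommGroup E] [NormedSpace ℝ E] [FiniteDimensional ℝ E]
  [Nontrivial E] [MeasurableSpace E] [BorelSpace E] (μ : Measure E) [μ.IsAddHaarMeasure]

theorem setLIntegral_ball_norm_rpow {b : ℝ} (hb : b < Module.finrank ℝ E) :
    ∃ A : ℝ, 0 ≤ A ∧ ∀ R : ℝ, 0 < R → ∫⁻ x in Metric.ball (0 : E) R, ENNReal.ofReal (‖x‖ ^ (-b)) ∂μ =
      ENNReal.ofReal (A * R ^ (Module.finrank ℝ E - b)) := by
  set n := Module.finrank ℝ E with hn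
  have hn0 : 0 < n := Module.finrank_pos
  refine ⟨n * μ.real (Metric.ball 0 1) / (n - b),
    div_nonneg (by positivity) (by linarith), fun R hR => ?_⟩
  set g : ℝ → ℝ := (Set.Iio R).indicator fun y => y ^ (-b)
  have hg : Set.EqOn (fun y => y ^ (n - 1) • g y)
      ((Set.Iio R).indicator fun y => y ^ (n - 1 - b)) (Set.Ioi 0) := by
    intro y hy
    have hy' : (0 : ℝ) < y := hy
    by_cases hyR : y < R
    · simp only [g, Set.indicator_of_mem (Set.mem_Iio.2 hyR), smul_eq_mul]
      rw [← Real.rpow_natCast, ← Real.rpow_add hy', Nat.cast_sub hn0]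
      simp [sub_eq_add_neg]
    · simp [g, Set.indicator_of_notMem (fun h : y ∈ Set.Iio R => hyR h)]
  have hset : Set.Iio R ∩ Set.Ioi 0 = Set.Ioo 0 R := by ext; simp [and_comm]
  have hint : IntegrableOn (fun y : ℝ => y ^ (n - 1 - b : ℝ)) (Set.Ioo 0 R) :=
    ((intervalIntegrable_iff_integrableOn_Ioo_of_le hR.le).1
      (intervalIntegral.intervalIntegrable_rpow' (by linarith)))
  have h1 : IntegrableOn (fun y : ℝ => y ^ (n - 1) • g y) (Set.Ioi 0) := by
    refine IntegrableOn.congr_fun ?_ hg.symm measurableSet_Ioi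
    rw [IntegrableOn, integrable_indicator_iff measurableSet_Iio, IntegrableOn,
      Measure.restrict_restrict measurableSet_Iio, hset]
    exact hint
  have h2 : Integrable (fun x : E => g ‖x‖) μ := (integrable_fun_norm_addHaar μ).2 h1
  have h3 : ∫ x : E, g ‖x‖ ∂μ = n * μ.real (Metric.ball 0 1) / (n - b) * R ^ (n - b) := by
    rw [integral_fun_norm_addHaar μ g, setIntegral_congr_fun measurableSet_Ioi hg,
      integral_indicator measurableSet_Iio, Measure.restrict_restrict measurableSet_Iio, hset,
      ← integral_Ioc_eq_integral_Ioo, ← intervalIntegral.integral_of_le hR.le,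
      integral_rpow (Or.inl (by linarith)), Real.zero_rpow (by linarith)]
    simp only [smul_eq_mul, nsmul_eq_mul, ← hn, sub_zero,
      show (n - 1 - b + 1 : ℝ) = n - b by ring]
    ring
  rw [← h3, ofReal_integral_eq_lintegral_ofReal h2 (Eventually.of_forall fun x => ?_),
    ← lintegral_indicator Metric.isOpen_ball.measurableSet]
  · refine lintegral_congr fun x => ?_
    by_cases hx : ‖x‖ < R
    · simp [g, hx]
    · simp [g, hx]
  · exact Set.indicator_nonneg (s := Set.Iio R) (f := fun y : ℝ => (|y|) ^ (-b))
      (fun y _ => by positivity) ‖x‖ |>.trans_eq (by by_cases hx : ‖x‖ < R <;> simp [g, hx])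

theorem setLIntegral_compl_ball_norm_rpow {c : ℝ} (hc : Module.finrank ℝ E < c) :
    ∃ A : ℝ, 0 ≤ A ∧ ∀ R : ℝ, 0 < R →
      ∫⁻ x in (Metric.ball (0 : E) R)ᶜ, ENNReal.ofReal (‖x‖ ^ (-c)) ∂μ =
        ENNReal.ofReal (A * R ^ (Module.finrank ℝ E - c)) := by
  set n := Module.finrank ℝ E with hn
  have hn0 : 0 < n := Module.finrank_pos
  refine ⟨n * μ.real (Metric.ball 0 1) / (c - n),
    div_nonneg (by positivity) (by linarith), fun R hR => ?_⟩
  set g : ℝ → ℝ := (Set.Ici R).indicator fun y => y ^ (-c)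
  have hg : Set.EqOn (fun y => y ^ (n - 1) • g y)
      ((Set.Ici R).indicator fun y => y ^ (n - 1 - c)) (Set.Ioi 0) := by
    intro y hy
    have hy' : (0 : ℝ) < y := hy
    by_cases hyR : R ≤ y
    · simp only [g, Set.indicator_of_mem (Set.mem_Ici.2 hyR), smul_eq_mul]
      rw [← Real.rpow_natCast, ← Real.rpow_add hy', Nat.cast_sub hn0]
      simp [sub_eq_add_neg]
    · simp [g, Set.indicator_of_notMem (fun h : y ∈ Set.Ici R => hyR h)]
  have hset : Set.Ici R ∩ Set.Ioi 0 = Set.Ici R := by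
    ext x
    simpa using fun h => hR.trans_le h
  have hint : IntegrableOn (fun y : ℝ => y ^ (n - 1 - c : ℝ)) (Set.Ici R) :=
    (integrableOn_Ici_iff_integrableOn_Ioi).2 (integrableOn_Ioi_rpow_of_lt (by linarith) hR)
  have h1 : IntegrableOn (fun y : ℝ => y ^ (n - 1) • g y) (Set.Ioi 0) := by
    refine IntegrableOn.congr_fun ?_ hg.symm measurableSet_Ioi
    rw [IntegrableOn, integrable_indicator_iff measurableSet_Ici, IntegrableOn,
      Measure.restrict_restrict measurableSet_Ici, hset]
    exact hint
  have h2 : Integrable (fun x : E => g ‖x‖) μ := (integrable_fun_norm_addHaar μ).2 h1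
  have h3 : ∫ x : E, g ‖x‖ ∂μ = n * μ.real (Metric.ball 0 1) / (c - n) * R ^ (n - c) := by
    rw [integral_fun_norm_addHaar μ g, setIntegral_congr_fun measurableSet_Ioi hg,
      integral_indicator measurableSet_Ici, Measure.restrict_restrict measurableSet_Ici, hset,
      integral_Ici_eq_integral_Ioi, integral_Ioi_rpow_of_lt (by linarith) hR]
    simp only [smul_eq_mul, nsmul_eq_mul, ← hn, show (n - 1 - c + 1 : ℝ) = n - c by ring]
    rw [neg_div, ← div_neg, neg_sub]
    ring
  rw [← h3, ofReal_integral_eq_lintegral_ofReal h2 (Eventually.of_forall fun x => ?_),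
    ← lintegral_indicator Metric.isOpen_ball.measurableSet.compl]
  · refine lintegral_congr fun x => ?_
    by_cases hx : R ≤ ‖x‖
    · simp [g, hx]
    · simp [g, hx]
  · by_cases hx : R ≤ ‖x‖
    · simp only [g, Pi.zero_apply, Set.indicator_of_mem (Set.mem_Ici.2 hx)]
      positivity
    · simp [g, Set.indicator_of_notMem (fun h : ‖x‖ ∈ Set.Ici R => hx h)]

/-- The Riesz potential `∫ |x - y|⁻ᵇ f(y) dy` of a nonnegative function. -/
noncomputable def rieszPotential (b : ℝ) (f : E → ℝ≥0∞) (x : E) : ℝ≥0∞ :=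
  ∫⁻ y, ENNReal.ofReal (‖x - y‖ ^ (-b)) * f y ∂μ

variable {μ}

/-- The distribution function estimate behind the Hardy–Littlewood–Sobolev inequality: the
superlevel sets of the Riesz potential are controlled by the tails of `f`. -/
theorem exists_measure_rieszPotential_le {b p q : ℝ} (hb0 : 0 < b) (hb : b < Module.finrank ℝ E)
    (hp : 1 < p) (hpq : p < q) (hbpq : 1 / p - 1 / q = 1 - b / Module.finrank ℝ E) :
    ∃ K B : ℝ, 0 < K ∧ 0 ≤ B ∧ ∀ f : E → ℝ, Measurable f → (∀ x, 0 ≤ f x) →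
      ∫⁻ x, ENNReal.ofReal (f x) ^ p ∂μ ≤ 1 → ∀ t : ℝ, 0 < t →
        μ {x | ENNReal.ofReal (K * t) < rieszPotential μ b (fun y => ENNReal.ofReal (f y)) x} ≤
          ENNReal.ofReal (B * t ^ (-(q / p))) *
            ∫⁻ y in {y | t < f y ^ (p / q)}, ENNReal.ofReal (f y) ∂μ := by
  set n := Module.finrank ℝ E with hn
  have hn0 : (0 : ℝ) < n := hb0.trans hb
  have hp0 : 0 < p := by linarith
  have hq0 : 0 < q := by linarith
  obtain ⟨B, hB0, hB⟩ := setLIntegral_ball_norm_rpow μ hb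
  have hconj : p.conjExponent.HolderConjugate p := (Real.HolderConjugate.conjExponent hp).symm
  set p' := p.conjExponent with hp'
  have hp'0 : 0 < p' := hconj.pos
  have hpp' : 1 / p' = 1 - 1 / p := by
    have := hconj.inv_add_inv_eq_one
    simp only [one_div]; linarith
  have hdecay : n / p' - b = -(n / q) := by
    have h1 : n / p' = n * (1 / p') := by ring
    have h2 : b = n * (b / n) := by field_simp
    rw [h1, hpp', h2, show b / n = 1 - (1 / p - 1 / q) by linarith]
    field_simp
    ring
  have hc : (n : ℝ) < b * p' := by
    have : n / p' < b := by
      have : 0 < n / q := by positivity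
      linarith
    rwa [div_lt_iff₀ hp'0] at this
  obtain ⟨A, hA0, hA⟩ := setLIntegral_compl_ball_norm_rpow μ hc
  set A' := A ^ (1 / p') with hA'
  have hA'0 : 0 ≤ A' := by positivity
  -- The potential splits into the far kernel (at most `A' t`), the near kernel against small values
  -- of `f` (at most `B t`), and a remainder `J`. The extra `1` leaves `J ≥ t` on the superlevel
  -- set.
  refine ⟨A' + B + 1, B, by positivity, hB0, fun f hf hf0 hfp t ht => ?_⟩
  -- The far kernel has `L^p'` norm `A' R^(-n/q)`; this radius makes it equal to `A' t`.
  set R := t ^ (-(q / n)) with hRdef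
  have hR : 0 < R := by positivity
  have hRpow : ∀ s : ℝ, R ^ s = t ^ (-(q / n) * s) := fun s => (Real.rpow_mul ht.le _ _).symm
  -- Off this set `f ≤ t^(q/p)`, and `R^(n - b) t^(q/p) = t`, so the near kernel contributes a
  -- multiple of `t` there.
  set S := {y | t < f y ^ (p / q)} with hS
  have hSm : MeasurableSet S := measurableSet_lt measurable_const (hf.pow_const _)
  set k : E → ℝ≥0∞ := fun z => ENNReal.ofReal (‖z‖ ^ (-b)) with hk
  have hkm : Measurable k := by fun_prop
  set F : E → ℝ≥0∞ := fun y => ENNReal.ofReal (f y)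
  have hFm : Measurable F := hf.ennreal_ofReal
  set kin : E → ℝ≥0∞ := (Metric.ball 0 R).indicator k with hkin
  set kout : E → ℝ≥0∞ := (Metric.ball 0 R)ᶜ.indicator k with hkout
  have hkinm : Measurable kin := hkm.indicator Metric.isOpen_ball.measurableSet
  have hkoutm : Measurable kout := hkm.indicator Metric.isOpen_ball.measurableSet.compl
  have hkin_int : ∫⁻ z, kin z ∂μ = ENNReal.ofReal (B * R ^ (n - b)) := by
    rw [hkin, lintegral_indicator Metric.isOpen_ball.measurableSet]
    exact hB R hR
  have hkout_int : (∫⁻ z, kout z ^ p' ∂μ) ^ (1 / p') = ENNReal.ofReal (A' * t) := by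
    have h1 : ∫⁻ z, kout z ^ p' ∂μ = ENNReal.ofReal (A * R ^ (n - b * p')) := by
      rw [← hA R hR, ← lintegral_indicator Metric.isOpen_ball.measurableSet.compl]
      refine lintegral_congr fun z => ?_
      by_cases hz : z ∈ (Metric.ball (0 : E) R)ᶜ
      · rw [hkout, Set.indicator_of_mem hz, Set.indicator_of_mem hz,
          ENNReal.ofReal_rpow_of_nonneg (by positivity) hp'0.le, ← Real.rpow_mul (norm_nonneg _),
          neg_mul]
      · rw [hkout, Set.indicator_of_notMem hz, Set.indicator_of_notMem hz,
          ENNReal.zero_rpow_of_pos hp'0]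
    rw [h1, ENNReal.ofReal_rpow_of_nonneg (by positivity) (by positivity),
      Real.mul_rpow hA0 (by positivity), ← Real.rpow_mul hR.le, hRpow]
    congr 3
    have h2 : (n - b * p') * (1 / p') = -(n / q) := by
      rw [← hdecay]; field_simp
    rw [h2, show -(q / n) * -(n / q) = (1 : ℝ) by field_simp, Real.rpow_one]
  set J : E → ℝ≥0∞ := fun x => ∫⁻ y, kin (x - y) * S.indicator F y ∂μ with hJ
  have hbound : ∀ x, rieszPotential μ b F x ≤ ENNReal.ofReal ((A' + B) * t) + J x := by
    intro x
    have hm1 : Measurable fun y => kout (x - y) := hkoutm.comp (measurable_const.sub measurable_id)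
    have hm2 : Measurable fun y => kin (x - y) := hkinm.comp (measurable_const.sub measurable_id)
    have hout : ∫⁻ y, kout (x - y) * F y ∂μ ≤ ENNReal.ofReal (A' * t) := by
      refine (ENNReal.lintegral_mul_le_Lp_mul_Lq μ hconj hm1.aemeasurable hFm.aemeasurable).trans ?_
      rw [lintegral_sub_left_eq_self (fun z => kout z ^ p') x, hkout_int]
      refine mul_le_of_le_one_right' ?_
      exact ENNReal.rpow_le_one hfp (by positivity)
    have hin : ∫⁻ y, kin (x - y) * Sᶜ.indicator F y ∂μ ≤ ENNReal.ofReal (B * t) := by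
      have hle : ∀ y, kin (x - y) * Sᶜ.indicator F y ≤
          kin (x - y) * ENNReal.ofReal (t ^ (q / p)) := by
        intro y
        gcongr
        by_cases hy : y ∈ S
        · simp [hy]
        · rw [Set.indicator_of_mem (Set.mem_compl hy)]
          refine ENNReal.ofReal_le_ofReal ?_
          have h1 : f y ^ (p / q) ≤ t := not_lt.1 hy
          calc f y = (f y ^ (p / q)) ^ (q / p) := by
                rw [← Real.rpow_mul (hf0 y), show p / q * (q / p) = 1 by field_simp, Real.rpow_one]
            _ ≤ t ^ (q / p) := Real.rpow_le_rpow (by have := hf0 y; positivity) h1 (by positivity)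
      refine (lintegral_mono hle).trans ?_
      rw [lintegral_mul_const _ hm2, lintegral_sub_left_eq_self kin x, hkin_int,
        ← ENNReal.ofReal_mul (by positivity), hRpow, mul_assoc, ← Real.rpow_add ht]
      refine ENNReal.ofReal_le_ofReal (le_of_eq ?_)
      congr 1
      have h2 : -(q / n) * (n - b) + q / p = 1 := by
        have h3 : -(q / n) * (n - b) = -q * (1 - b / n) := by field_simp
        rw [h3, ← hbpq]
        field_simp
        ring
      rw [h2, Real.rpow_one]
    have hsplit : ∀ y, k (x - y) * F y = kout (x - y) * F y +
        (kin (x - y) * Sᶜ.indicator F y + kin (x - y) * S.indicator F y) := by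
      intro y
      rw [← mul_add, ← Pi.add_apply (Sᶜ.indicator F), Set.indicator_compl_add_self, ← add_mul,
        ← Pi.add_apply kout, hkin, hkout, Set.indicator_compl_add_self]
    calc rieszPotential μ b F x = ∫⁻ y, kout (x - y) * F y ∂μ +
          (∫⁻ y, kin (x - y) * Sᶜ.indicator F y ∂μ + J x) := by
          have hm3 : Measurable fun y => kout (x - y) * F y := hm1.mul hFm
          have hm4 : Measurable fun y => kin (x - y) * Sᶜ.indicator F y :=
            hm2.mul (hFm.indicator hSm.compl)
          rw [rieszPotential, lintegral_congr hsplit, lintegral_add_left hm3,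
            lintegral_add_left hm4]
      _ ≤ ENNReal.ofReal (A' * t) + (ENNReal.ofReal (B * t) + J x) := by gcongr
      _ = _ := by rw [← add_assoc, ← ENNReal.ofReal_add (by positivity) (by positivity), ← add_mul]
  have hJm : Measurable (Function.uncurry fun x y => kin (x - y) * S.indicator F y) :=
    (hkinm.comp (measurable_fst.sub measurable_snd)).mul
      ((hFm.indicator hSm).comp measurable_snd)
  have hJint : ∫⁻ x, J x ∂μ = ENNReal.ofReal (B * R ^ (n - b)) * ∫⁻ y in S, F y ∂μ := by
    rw [hJ, lintegral_lintegral_swap hJm.aemeasurable, ← lintegral_indicator hSm,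
      ← lintegral_const_mul _ (hFm.indicator hSm)]
    refine lintegral_congr fun y => ?_
    have hm : Measurable fun x => kin (x - y) := hkinm.comp (measurable_id.sub measurable_const)
    rw [lintegral_mul_const _ hm, lintegral_sub_right_eq_self kin y, hkin_int]
  have hsub : {x | ENNReal.ofReal ((A' + B + 1) * t) < rieszPotential μ b F x} ⊆
      {x | ENNReal.ofReal t ≤ J x} := by
    intro x hx
    by_contra hlt
    have h1 : J x < ENNReal.ofReal t := not_le.1 hlt
    have h2 : rieszPotential μ b F x ≤ ENNReal.ofReal ((A' + B + 1) * t) := by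
      refine (hbound x).trans ?_
      rw [add_mul _ 1, one_mul, ENNReal.ofReal_add (by positivity) ht.le]
      gcongr
    exact absurd hx (not_lt.2 h2)
  -- Markov's inequality suffices for the large values of `f`, since the near kernel is integrable
  -- and Fubini computes `∫ J` exactly.
  have hmarkov : ENNReal.ofReal t * μ {x | ENNReal.ofReal t ≤ J x} ≤ ∫⁻ x, J x ∂μ :=
    mul_meas_ge_le_lintegral₀ hJm.lintegral_prod_right'.aemeasurable _
  have htne : ENNReal.ofReal t ≠ 0 := by simpa using ht
  calc μ {x | ENNReal.ofReal ((A' + B + 1) * t) < rieszPotential μ b F x}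
      ≤ μ {x | ENNReal.ofReal t ≤ J x} := measure_mono hsub
    _ ≤ (ENNReal.ofReal t)⁻¹ * ∫⁻ x, J x ∂μ := by
        rw [mul_comm] at hmarkov
        rw [mul_comm, ← div_eq_mul_inv]
        exact (ENNReal.le_div_iff_mul_le (Or.inl htne) (Or.inl ENNReal.ofReal_ne_top)).2 hmarkov
    _ = ENNReal.ofReal (B * t ^ (-(q / p))) * ∫⁻ y in S, F y ∂μ := by
        rw [hJint, ← mul_assoc, ← ENNReal.ofReal_inv_of_pos ht,
          ← ENNReal.ofReal_mul (by positivity)]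
        congr 2
        rw [hRpow, ← Real.rpow_neg_one, mul_left_comm, ← Real.rpow_add ht]
        congr 2
        have h3 : -(q / n) * (n - b) = -q * (1 - b / n) := by field_simp
        rw [h3, ← hbpq]
        field_simp
        ring

/-- **Hardy–Littlewood–Sobolev inequality**, in normalized form. -/
theorem exists_lintegral_rpow_le_of_le_rieszPotential {b p q : ℝ} (hb0 : 0 < b)
    (hb : b < Module.finrank ℝ E) (hp : 1 < p) (hpq : p < q)
    (hbpq : 1 / p - 1 / q = 1 - b / Module.finrank ℝ E) :
    ∃ C : ℝ, 0 ≤ C ∧ ∀ f h : E → ℝ, Measurable f → (∀ x, 0 ≤ f x) → Measurable h →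
      (∀ x, 0 ≤ h x) → ∫⁻ x, ENNReal.ofReal (f x) ^ p ∂μ ≤ 1 →
      (∀ x, ENNReal.ofReal (h x) ≤ rieszPotential μ b (fun y => ENNReal.ofReal (f y)) x) →
        ∫⁻ x, ENNReal.ofReal (h x) ^ q ∂μ ≤ ENNReal.ofReal C := by
  obtain ⟨K, B, hK, hB, hmain⟩ := exists_measure_rieszPotential_le (μ := μ) hb0 hb hp hpq hbpq
  have hp0 : 0 < p := by linarith
  have hq0 : 0 < q := by linarith
  have hr : 0 < q - q / p := by
    have : q / p < q := div_lt_self hq0 hp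
    linarith
  refine ⟨K ^ q * (q * (B * (q - q / p)⁻¹)), by positivity, fun f h hf hf0 hh hh0 hfp hle => ?_⟩
  -- The layer-cake formula is used twice: for `h` under `μ`, and for `f^(p/q)` under `f dμ` with
  -- exponent `q - q/p`. The powers of `t` match because `(q - 1) - q/p = (q - q/p) - 1`, and
  -- `(p/q)(q - q/p) = p - 1` turns the tail integral back into `∫ f^p`.
  set ν := μ.withDensity fun y => ENNReal.ofReal (f y) with hν
  have hSm : ∀ t, MeasurableSet {y | t < f y ^ (p / q)} := fun t =>
    measurableSet_lt measurable_const (hf.pow_const _)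
  have hdist : ∀ t : ℝ, 0 < t → μ {x | t < h x / K} ≤
      ENNReal.ofReal (B * t ^ (-(q / p))) * ν {y | t < f y ^ (p / q)} := by
    intro t ht
    rw [hν, withDensity_apply _ (hSm t)]
    refine (measure_mono fun x hx => ?_).trans (hmain f hf hf0 hfp t ht)
    have hx' : K * t < h x := by
      have : t < h x / K := hx
      rwa [lt_div_iff₀ hK, mul_comm] at this
    exact ((ENNReal.ofReal_lt_ofReal_iff (lt_of_le_of_lt (by positivity) hx')).2 hx').trans_le
      (hle x)
  have hlayer := lintegral_rpow_eq_lintegral_meas_lt_mul μ (f := fun x => h x / K)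
    (Eventually.of_forall fun x => div_nonneg (hh0 x) hK.le) (hh.div_const K).aemeasurable hq0
  have hlayer' := lintegral_rpow_eq_lintegral_meas_lt_mul ν (f := fun y => f y ^ (p / q))
    (Eventually.of_forall fun x => Real.rpow_nonneg (hf0 x) _) (hf.pow_const _).aemeasurable hr
  have hfpow : ∫⁻ y, ENNReal.ofReal ((f y ^ (p / q)) ^ (q - q / p)) ∂ν ≤ 1 := by
    rw [hν, lintegral_withDensity_eq_lintegral_mul μ hf.ennreal_ofReal
      ((hf.pow_const _).pow_const _).ennreal_ofReal]
    refine le_trans (lintegral_mono fun y => ?_) hfp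
    rw [Pi.mul_apply, ← ENNReal.ofReal_mul (hf0 y), ENNReal.ofReal_rpow_of_nonneg (hf0 y) hp0.le,
      ← Real.rpow_mul (hf0 y), show p / q * (q - q / p) = p - 1 by field_simp]
    refine ENNReal.ofReal_le_ofReal (le_of_eq ?_)
    rw [mul_comm, ← Real.rpow_add_one' (hf0 y) (by linarith)]
    ring_nf
  have htail : ∫⁻ t in Set.Ioi (0 : ℝ), ν {y | t < f y ^ (p / q)} *
      ENNReal.ofReal (t ^ (q - q / p - 1)) ≤ ENNReal.ofReal (q - q / p)⁻¹ := by
    rw [hlayer'] at hfpow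
    rw [ENNReal.ofReal_inv_of_pos hr, ← one_div, ENNReal.le_div_iff_mul_le
      (Or.inl (by simpa using hr)) (Or.inl ENNReal.ofReal_ne_top), mul_comm]
    exact hfpow
  have hscaled : ∫⁻ x, ENNReal.ofReal ((h x / K) ^ q) ∂μ ≤
      ENNReal.ofReal (q * (B * (q - q / p)⁻¹)) := by
    rw [hlayer, ENNReal.ofReal_mul hq0.le, ENNReal.ofReal_mul hB]
    gcongr
    calc ∫⁻ t in Set.Ioi (0 : ℝ), μ {x | t < h x / K} * ENNReal.ofReal (t ^ (q - 1))
        ≤ ∫⁻ t in Set.Ioi (0 : ℝ), ENNReal.ofReal B * (ν {y | t < f y ^ (p / q)} *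
            ENNReal.ofReal (t ^ (q - q / p - 1))) := by
          refine setLIntegral_mono' measurableSet_Ioi fun t ht => ?_
          have ht' : (0 : ℝ) < t := ht
          refine (mul_le_mul_left (hdist t ht') _).trans (le_of_eq ?_)
          rw [ENNReal.ofReal_mul hB, show q - q / p - 1 = -(q / p) + (q - 1) by ring,
            Real.rpow_add ht', ENNReal.ofReal_mul (by positivity)]
          ring
      _ = ENNReal.ofReal B * ∫⁻ t in Set.Ioi (0 : ℝ), ν {y | t < f y ^ (p / q)} *
            ENNReal.ofReal (t ^ (q - q / p - 1)) :=
          lintegral_const_mul' _ _ ENNReal.ofReal_ne_top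
      _ ≤ _ := by gcongr
  calc ∫⁻ x, ENNReal.ofReal (h x) ^ q ∂μ
      = ∫⁻ x, ENNReal.ofReal (K ^ q) * ENNReal.ofReal ((h x / K) ^ q) ∂μ := by
        refine lintegral_congr fun x => ?_
        rw [← ENNReal.ofReal_mul (by positivity), ← Real.mul_rpow hK.le (div_nonneg (hh0 x) hK.le),
          mul_div_cancel₀ _ hK.ne', ENNReal.ofReal_rpow_of_nonneg (hh0 x) hq0.le]
    _ = ENNReal.ofReal (K ^ q) * ∫⁻ x, ENNReal.ofReal ((h x / K) ^ q) ∂μ :=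
        lintegral_const_mul' _ _ ENNReal.ofReal_ne_top
    _ ≤ _ := by
        rw [ENNReal.ofReal_mul (by positivity)]
        gcongr

end FractionalIntegration

end Helmholtz
namespace Helmholtz

/-! ### The Hardy–Littlewood–Sobolev inequality for norms. -/

section FractionalIntegration

variable {E : Type*} [NormedAddCommGroup E] [NormedSpace ℝ E] [FiniteDimensional ℝ E]
  [Nontrivial E] [MeasurableSpace E] [BorelSpace E] {μ : Measure E} [μ.IsAddHaarMeasure]

/-- **Hardy–Littlewood–Sobolev inequality**: a function dominated by the Riesz potential of `‖g‖`
is controlled in `Lᵠ` by the `Lᵖ` norm of `g`. -/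
theorem exists_eLpNorm_le_of_le_rieszPotential {b p q : ℝ} (hb0 : 0 < b)
    (hb : b < Module.finrank ℝ E) (hp : 1 < p) (hpq : p < q)
    (hbpq : 1 / p - 1 / q = 1 - b / Module.finrank ℝ E) :
    ∃ C : ℝ, 0 ≤ C ∧ ∀ g h : E → ℂ, Measurable g → Measurable h →
      eLpNorm g (ENNReal.ofReal p) μ < ⊤ →
      (∀ x, ‖h x‖ₑ ≤ rieszPotential μ b (fun y => ‖g y‖ₑ) x) →
        eLpNorm h (ENNReal.ofReal q) μ ≤ ENNReal.ofReal C * eLpNorm g (ENNReal.ofReal p) μ := by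
  obtain ⟨C, hC0, hC⟩ := exists_lintegral_rpow_le_of_le_rieszPotential (μ := μ) hb0 hb hp hpq hbpq
  have hp0 : 0 < p := by linarith
  have hq0 : 0 < q := by linarith
  have hpne : ENNReal.ofReal p ≠ 0 := by simpa using hp0
  refine ⟨C ^ (1 / q), by positivity, fun g h hg hh hgp hle => ?_⟩
  -- Dividing by the norm of `g` is impossible when it vanishes; then the potential, hence `h`, is
  -- zero everywhere.
  rcases eq_or_ne (eLpNorm g (ENNReal.ofReal p) μ) 0 with h0 | h0
  · have hg0 : g =ᵐ[μ] 0 := (eLpNorm_eq_zero_iff hg.aestronglyMeasurable hpne).1 h0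
    have hh0 : h = 0 := by
      funext x
      have hx : ‖h x‖ₑ ≤ 0 := by
        refine (hle x).trans (le_of_eq ?_)
        rw [rieszPotential, lintegral_congr_ae (g := fun _ => 0), lintegral_zero]
        filter_upwards [hg0] with y hy
        simp [hy]
      simpa using hx
    simp [hh0]
  · set M := (eLpNorm g (ENNReal.ofReal p) μ).toReal with hM
    have hM0 : 0 < M := ENNReal.toReal_pos h0 hgp.ne
    have hMe : ENNReal.ofReal M = eLpNorm g (ENNReal.ofReal p) μ := ENNReal.ofReal_toReal hgp.ne
    have hdiv : ∀ z : ℂ, ENNReal.ofReal (‖z‖ / M) = ‖z‖ₑ * ENNReal.ofReal M⁻¹ := fun z => by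
      rw [div_eq_mul_inv, ENNReal.ofReal_mul (norm_nonneg _), ofReal_norm]
    have hpow : ∀ (r : ℝ), 0 < r → ∀ φ : E → ℂ, ∫⁻ x, ENNReal.ofReal (‖φ x‖ / M) ^ r ∂μ =
        (eLpNorm φ (ENNReal.ofReal r) μ * ENNReal.ofReal M⁻¹) ^ r := by
      intro r hr φ
      rw [eLpNorm_eq_lintegral_rpow_enorm_toReal (by simpa using hr) ENNReal.ofReal_ne_top,
        ENNReal.toReal_ofReal hr.le, ENNReal.mul_rpow_of_nonneg _ _ hr.le, ← ENNReal.rpow_mul,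
        one_div_mul_cancel hr.ne', ENNReal.rpow_one, ← lintegral_mul_const' _ _
          (ENNReal.rpow_ne_top_of_nonneg hr.le ENNReal.ofReal_ne_top)]
      refine lintegral_congr fun x => ?_
      rw [hdiv, ENNReal.mul_rpow_of_nonneg _ _ hr.le]
    have hinv : ENNReal.ofReal M * ENNReal.ofReal M⁻¹ = 1 := by
      rw [← ENNReal.ofReal_mul hM0.le, mul_inv_cancel₀ hM0.ne', ENNReal.ofReal_one]
    have key := hC (fun x => ‖g x‖ / M) (fun x => ‖h x‖ / M) (hg.norm.div_const _)
      (fun x => by positivity) (hh.norm.div_const _) (fun x => by positivity)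
      (by rw [hpow p hp0, ← hMe, hinv, ENNReal.one_rpow]) (fun x => by
        simp only [rieszPotential, hdiv]
        simp_rw [← mul_assoc]
        rw [lintegral_mul_const' _ _ ENNReal.ofReal_ne_top]
        gcongr
        exact hle x)
    rw [hpow q hq0] at key
    have key2 : eLpNorm h (ENNReal.ofReal q) μ * ENNReal.ofReal M⁻¹ ≤
        ENNReal.ofReal (C ^ (1 / q)) := by
      rw [← ENNReal.ofReal_rpow_of_nonneg hC0 (by positivity), one_div]
      exact (ENNReal.le_rpow_inv_iff hq0).2 key
    calc eLpNorm h (ENNReal.ofReal q) μ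
        = eLpNorm h (ENNReal.ofReal q) μ * ENNReal.ofReal M⁻¹ * ENNReal.ofReal M := by
          rw [mul_assoc, mul_comm (ENNReal.ofReal M⁻¹), hinv, mul_one]
      _ ≤ ENNReal.ofReal (C ^ (1 / q)) * ENNReal.ofReal M := by gcongr
      _ = _ := by rw [hMe]

end FractionalIntegration

end Helmholtz
namespace Helmholtz

open scoped FourierTransform

/-! ### Derivative bounds of homogeneous type. -/

section KernelBound

variable {E : Type*} [NormedAddCommGroup E] [NormedSpace ℝ E]

/-- The derivatives of `f` up to order `n` are bounded by those of a function homogeneous of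
degree `-a`. -/
def HomogeneousBound (n : ℕ) (a C : ℝ) (f : E → ℂ) : Prop :=
  ∀ k ≤ n, ∀ ξ ≠ 0, ‖iteratedFDeriv ℝ k f ξ‖ ≤ C * ‖ξ‖ ^ (-a - k)

namespace HomogeneousBound

variable {n : ℕ} {a b C D : ℝ} {f g : E → ℂ}

theorem mul (hC : 0 ≤ C) (hf : HomogeneousBound n a C f)
    (hg : HomogeneousBound n b D g) (hf' : ContDiff ℝ ∞ f) (hg' : ContDiff ℝ ∞ g) :
    HomogeneousBound n (a + b) (2 ^ n * (C * D)) fun ξ => f ξ * g ξ := by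
  intro k hk ξ hξ
  have hξ' : 0 < ‖ξ‖ := norm_pos_iff.2 hξ
  have hCD : 0 ≤ C * D := by
    have hg0 := (norm_nonneg _).trans (hg 0 (Nat.zero_le n) ξ hξ)
    exact mul_nonneg hC (nonneg_of_mul_nonneg_left hg0 (by positivity))
  refine (norm_iteratedFDeriv_mul_le hf' hg' ξ (mod_cast le_top)).trans ?_
  calc ∑ i ∈ Finset.range (k + 1), (k.choose i : ℝ) * ‖iteratedFDeriv ℝ i f ξ‖ *
        ‖iteratedFDeriv ℝ (k - i) g ξ‖
      ≤ ∑ i ∈ Finset.range (k + 1), (k.choose i : ℝ) * (C * D * ‖ξ‖ ^ (-(a + b) - k)) := by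
        refine Finset.sum_le_sum fun i hi => ?_
        have hik : i ≤ k := by simpa [Nat.lt_succ_iff] using hi
        rw [mul_assoc]
        refine mul_le_mul_of_nonneg_left ?_ (Nat.cast_nonneg _)
        refine (mul_le_mul (hf i (hik.trans hk) ξ hξ) (hg (k - i) ((Nat.sub_le _ _).trans hk) ξ hξ)
          (norm_nonneg _) (by positivity)).trans (le_of_eq ?_)
        rw [mul_mul_mul_comm, ← Real.rpow_add hξ', Nat.cast_sub hik]
        ring_nf
    _ = 2 ^ k * (C * D * ‖ξ‖ ^ (-(a + b) - k)) := by
        rw [← Finset.sum_mul, ← Nat.cast_sum, Nat.sum_range_choose]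
        push_cast
        rfl
    _ ≤ 2 ^ n * (C * D * ‖ξ‖ ^ (-(a + b) - k)) := by
        gcongr
        norm_num
    _ = _ := by ring

/-- In degree zero the chain-rule factor `c^k` cancels against the `c^(-k)` from the bound, so the
constant is independent of the scale. This makes estimates with dilated cut-offs uniform. -/
theorem comp_smul (hf : HomogeneousBound n 0 C f) (hf' : ContDiff ℝ ∞ f) {c : ℝ} (hc : 0 < c) :
    HomogeneousBound n 0 C fun ξ => f (c • ξ) := by
  intro k hk ξ hξ
  have hξ' : 0 < ‖ξ‖ := norm_pos_iff.2 hξ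
  rw [iteratedFDeriv_comp_const_smul c (hf'.of_le (mod_cast le_top)), norm_smul, norm_pow,
    Real.norm_of_nonneg hc.le]
  have h := hf k hk (c • ξ) (smul_ne_zero hc.ne' hξ)
  rw [norm_smul, Real.norm_of_nonneg hc.le, Real.mul_rpow hc.le hξ'.le] at h
  calc c ^ k * ‖iteratedFDeriv ℝ k f (c • ξ)‖
      ≤ c ^ k * (C * (c ^ (-0 - k : ℝ) * ‖ξ‖ ^ (-0 - k : ℝ))) := by gcongr
    _ = (c ^ (k : ℝ) * c ^ (-0 - k : ℝ)) * (C * ‖ξ‖ ^ (-0 - k : ℝ)) := by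
        rw [Real.rpow_natCast]; ring
    _ = _ := by rw [← Real.rpow_add hc]; simp

theorem one_sub (hf : HomogeneousBound n 0 C f) (hf' : ContDiff ℝ ∞ f) :
    HomogeneousBound n 0 (1 + C) fun ξ => 1 - f ξ := by
  intro k hk ξ hξ
  have hξ' : 0 < ‖ξ‖ := norm_pos_iff.2 hξ
  have hsub : iteratedFDeriv ℝ k (fun ξ => 1 - f ξ) ξ =
      iteratedFDeriv ℝ k (fun _ : E => (1 : ℂ)) ξ - iteratedFDeriv ℝ k f ξ :=
    iteratedFDeriv_sub_apply contDiffAt_const (hf'.contDiffAt.of_le (mod_cast le_top))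
  rw [hsub, add_mul]
  refine (norm_sub_le _ _).trans (add_le_add ?_ (hf k hk ξ hξ))
  rcases Nat.eq_zero_or_pos k with rfl | hk0
  · simp
  · rw [iteratedFDeriv_const_of_ne hk0.ne']
    simp only [Pi.zero_apply, norm_zero]
    positivity

/-- Such a function is Schwartz, and its decay estimate with weight `‖ξ‖^k` on the `k`-th derivative
is exactly the required bound. -/
theorem of_hasCompactSupport (n : ℕ) (hf : HasCompactSupport f) (hf' : ContDiff ℝ ∞ f) :
    ∃ C : ℝ, 0 ≤ C ∧ HomogeneousBound n 0 C f := by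
  choose C hC0 hC using fun k => (hf.toSchwartzMap hf').decay k k
  refine ⟨∑ k ∈ Finset.range (n + 1), C k, Finset.sum_nonneg fun k _ => (hC0 k).le,
    fun k hk ξ hξ => ?_⟩
  have hξ' : 0 < ‖ξ‖ := norm_pos_iff.2 hξ
  rw [neg_zero, zero_sub, Real.rpow_neg hξ'.le, Real.rpow_natCast, ← div_eq_mul_inv,
    le_div_iff₀ (by positivity), mul_comm]
  exact (hC k ξ).trans (Finset.single_le_sum (f := C) (fun i _ => (hC0 i).le)
    (Finset.mem_range.2 (by omega)))

end HomogeneousBound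

end KernelBound

/-! ### Fourier transforms of functions with homogeneous bounds. -/

section KernelBound

variable {E : Type*} [NormedAddCommGroup E] [InnerProductSpace ℝ E] [FiniteDimensional ℝ E]

/-- A smooth radial cut-off between the balls of radius one and two. -/
theorem exists_bump (E : Type*) [NormedAddCommGroup E] [InnerProductSpace ℝ E]
    [FiniteDimensional ℝ E] :
    ∃ χ : E → ℂ, ContDiff ℝ ∞ χ ∧ HasCompactSupport χ ∧ (∀ ξ, ‖χ ξ‖ ≤ 1) ∧
      (∀ ξ, ‖ξ‖ ≤ 1 → χ ξ = 1) ∧ ∀ ξ, 2 ≤ ‖ξ‖ → χ ξ = 0 := by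
  let B : ContDiffBump (0 : E) := ⟨1, 2, one_pos, one_lt_two⟩
  refine ⟨fun ξ => (B ξ : ℂ), ?_, ?_, fun ξ => ?_, fun ξ hξ => ?_, fun ξ hξ => ?_⟩
  · exact Complex.ofRealCLM.contDiff.comp B.contDiff
  · exact B.hasCompactSupport.comp_left (g := fun r : ℝ => (r : ℂ)) Complex.ofReal_zero
  · rw [Complex.norm_real, Real.norm_of_nonneg B.nonneg]
    exact B.le_one
  · beta_reduce
    rw [B.one_of_mem_closedBall (by simpa using hξ), Complex.ofReal_one]
  · beta_reduce
    rw [B.zero_of_le_dist (by simpa using hξ), Complex.ofReal_zero]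

variable [MeasurableSpace E] [BorelSpace E]

theorem enorm_fourier_le (f : E → ℂ) (w : E) : ‖𝓕 f w‖ₑ ≤ ∫⁻ ξ, ‖f ξ‖ₑ := by
  rw [Real.fourier_eq']
  refine (enorm_integral_le_lintegral_enorm _).trans (le_of_eq ?_)
  refine lintegral_congr fun ξ => ?_
  rw [enorm_smul, ← ofReal_norm, Complex.norm_exp_ofReal_mul_I, ENNReal.ofReal_one, one_mul]

theorem enorm_pow_mul_fourier_le {f : E → ℂ} (hf : ContDiff ℝ ∞ f) (hf' : HasCompactSupport f)
    (n : ℕ) (w : E) :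
    ENNReal.ofReal ((2 * Real.pi * ‖w‖) ^ n) * ‖𝓕 f w‖ₑ ≤ ∫⁻ ξ, ‖iteratedFDeriv ℝ n f ξ‖ₑ := by
  rcases eq_or_ne w 0 with rfl | hw
  · rcases Nat.eq_zero_or_pos n with rfl | hn
    · simp only [pow_zero, ENNReal.ofReal_one, one_mul]
      refine (enorm_fourier_le f 0).trans (lintegral_mono fun ξ => ?_)
      rw [← ofReal_norm, ← ofReal_norm, norm_iteratedFDeriv_zero]
    · simp [hn.ne']
  have hint : ∀ k : ℕ, (k : ℕ∞) ≤ (⊤ : ℕ∞) → Integrable (iteratedFDeriv ℝ k f) := fun k _ =>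
    (hf.continuous_iteratedFDeriv (mod_cast le_top)).integrable_of_hasCompactSupport
      (hf'.iteratedFDeriv k)
  have hF := congrFun (Real.fourier_iteratedFDeriv (N := ⊤) hf hint (n := n) le_top) w
  have h1 : (2 * Real.pi * ‖w‖) ^ n * ‖𝓕 f w‖ ≤ ‖𝓕 (iteratedFDeriv ℝ n f) w‖ := by
    -- Evaluating the multilinear form at `(w, …, w)` yields `⟪w, w⟫ⁿ`, that is `‖w‖^(2n)`; dividing
    -- by the `‖w‖ⁿ` of the operator norm bound leaves `‖w‖ⁿ`.
    have h2 := (𝓕 (iteratedFDeriv ℝ n f) w).le_opNorm fun _ => w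
    have hw' : 0 < ‖w‖ := norm_pos_iff.2 hw
    nth_rewrite 1 [hF] at h2
    rw [VectorFourier.fourierPowSMulRight_apply] at h2
    simp only [Finset.prod_const, Finset.card_univ, Fintype.card_fin, norm_smul, norm_pow,
      norm_neg, norm_mul, Complex.norm_ofNat, Complex.norm_real, Complex.norm_I, mul_one,
      neg_apply, Real.norm_of_nonneg Real.pi_pos.le] at h2
    rw [show ‖innerSL ℝ w w‖ = ‖w‖ ^ 2 by
      rw [innerSL_apply_apply, real_inner_self_eq_norm_sq, norm_pow, norm_norm]] at h2
    refine le_of_mul_le_mul_right (le_trans (le_of_eq ?_) h2) (pow_pos hw' n)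
    rw [mul_pow]
    ring
  rw [← ofReal_norm, ← ENNReal.ofReal_mul (by positivity)]
  refine (ENNReal.ofReal_le_ofReal h1).trans ?_
  rw [ofReal_norm, Real.fourier_eq']
  refine (enorm_integral_le_lintegral_enorm _).trans (le_of_eq ?_)
  refine lintegral_congr fun ξ => ?_
  rw [enorm_smul, ← ofReal_norm, Complex.norm_exp_ofReal_mul_I, ENNReal.ofReal_one, one_mul]

/-- The Fourier transform of a compactly supported function obeying the bounds of a function
homogeneous of degree `-a` obeys the bounds of a function homogeneous of degree `a - n`. -/
theorem exists_fourier_le_of_homogeneousBound [Nontrivial E] {a C : ℝ} (ha0 : 0 < a)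
    (ha : a < Module.finrank ℝ E) (hC : 0 ≤ C) :
    ∃ K : ℝ, 0 ≤ K ∧ ∀ u : E → ℂ, ContDiff ℝ ∞ u → HasCompactSupport u →
      HomogeneousBound (Module.finrank ℝ E) a C u → ∀ w ≠ 0,
        ‖𝓕 u w‖ ≤ K * ‖w‖ ^ (-(Module.finrank ℝ E - a)) := by
  set n := Module.finrank ℝ E with hn
  obtain ⟨A, hA0, hA⟩ := setLIntegral_ball_norm_rpow (volume : Measure E) ha
  obtain ⟨B, hB0, hB⟩ := setLIntegral_compl_ball_norm_rpow (volume : Measure E)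
    (c := a + n) (by rw [← hn]; linarith)
  obtain ⟨χ, hχ, hχc, hχ1, hχ_one, hχ_zero⟩ := exists_bump E
  obtain ⟨D, hD0, hD⟩ := HomogeneousBound.of_hasCompactSupport n hχc hχ
  set C' := 2 ^ n * (C * (1 + D)) with hC'
  have hC'0 : 0 ≤ C' := by positivity
  refine ⟨C * (A * 3 ^ (n - a)) + C' * B, by positivity, fun u hu huc hub w hw => ?_⟩
  have hw' : 0 < ‖w‖ := norm_pos_iff.2 hw
  -- Frequencies are split at the scale `1/‖w‖`: below it the phase hardly oscillates and absolute
  -- integrability is used, above it integration by parts.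
  set R := ‖w‖⁻¹ with hR
  have hR0 : 0 < R := by positivity
  set χw : E → ℂ := fun ξ => χ (‖w‖ • ξ) with hχw
  have hχw' : ContDiff ℝ ∞ χw := hχ.comp (contDiff_const_smul _)
  have hχwb : HomogeneousBound n 0 D χw := hD.comp_smul hχ hw'
  set u₁ : E → ℂ := fun ξ => u ξ * χw ξ
  set u₂ : E → ℂ := fun ξ => u ξ * (1 - χw ξ)
  have hu₁ : ContDiff ℝ ∞ u₁ := hu.mul hχw'
  have hu₂ : ContDiff ℝ ∞ u₂ := hu.mul (contDiff_const.sub hχw')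
  have hu₁c : HasCompactSupport u₁ := huc.mul_right
  have hu₂c : HasCompactSupport u₂ := huc.mul_right
  have hsum : 𝓕 u w = 𝓕 u₁ w + 𝓕 u₂ w := by
    have hi₁ : Integrable u₁ := hu₁.continuous.integrable_of_hasCompactSupport hu₁c
    have hi₂ : Integrable u₂ := hu₂.continuous.integrable_of_hasCompactSupport hu₂c
    have hadd : u = u₁ + u₂ := by funext ξ; simp only [u₁, u₂, Pi.add_apply]; ring
    rw [hadd, Real.fourier_eq, Real.fourier_eq, Real.fourier_eq, ← integral_add]
    · simp
    · simpa using (Real.fourierIntegral_convergent_iff w).2 hi₁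
    · simpa using (Real.fourierIntegral_convergent_iff w).2 hi₂
  have h1 : ‖𝓕 u₁ w‖ₑ ≤ ENNReal.ofReal (C * (A * (3 * R) ^ (n - a))) := by
    refine (enorm_fourier_le u₁ w).trans ?_
    rw [ENNReal.ofReal_mul hC, ← hA (3 * R) (by positivity),
      ← lintegral_const_mul' _ _ ENNReal.ofReal_ne_top,
      ← lintegral_indicator Metric.isOpen_ball.measurableSet]
    refine lintegral_mono_ae ?_
    filter_upwards [compl_mem_ae_iff.2 (measure_singleton (0 : E))] with ξ hξ
    by_cases hξR : ξ ∈ Metric.ball (0 : E) (3 * R)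
    · rw [Set.indicator_of_mem hξR, ← ENNReal.ofReal_mul hC, ← ofReal_norm]
      refine ENNReal.ofReal_le_ofReal ?_
      have h := hub 0 (Nat.zero_le _) ξ hξ
      rw [norm_iteratedFDeriv_zero, Nat.cast_zero, sub_zero] at h
      rw [norm_mul]
      exact (mul_le_of_le_one_right (norm_nonneg _) (hχ1 _)).trans h
    · have hz : χw ξ = 0 := by
        refine hχ_zero _ ?_
        rw [norm_smul, norm_norm]
        have : 3 * R ≤ ‖ξ‖ := by simpa using hξR
        calc (2 : ℝ) ≤ ‖w‖ * (3 * R) := by rw [hR]; field_simp; norm_num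
          _ ≤ _ := by gcongr
      simp [u₁, hz]
  have hb₂ : HomogeneousBound n (a + 0) C' u₂ :=
    hub.mul hC (hχwb.one_sub hχw') hu (contDiff_const.sub hχw')
  -- Because `a > 0`, as many derivatives as the dimension already make `‖ξ‖^(-a - n)` integrable
  -- away from the origin.
  have h2 : ENNReal.ofReal ((2 * Real.pi * ‖w‖) ^ n) * ‖𝓕 u₂ w‖ₑ ≤
      ENNReal.ofReal (C' * (B * R ^ (-a))) := by
    refine (enorm_pow_mul_fourier_le hu₂ hu₂c n w).trans ?_
    rw [ENNReal.ofReal_mul hC'0, show -a = n - (a + n) by ring, ← hB R hR0,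
      ← lintegral_const_mul' _ _ ENNReal.ofReal_ne_top,
      ← lintegral_indicator Metric.isOpen_ball.measurableSet.compl]
    refine lintegral_mono fun ξ => ?_
    by_cases hξR : ξ ∈ Metric.ball (0 : E) R
    · have hz : u₂ =ᶠ[𝓝 ξ] fun _ => 0 := by
        filter_upwards [Metric.isOpen_ball.mem_nhds hξR] with η hη
        have : ‖η‖ < R := by simpa using hη
        have hη1 : ‖‖w‖ • η‖ ≤ 1 := by
          rw [norm_smul, norm_norm]
          calc ‖w‖ * ‖η‖ ≤ ‖w‖ * R := by gcongr
            _ = 1 := by rw [hR]; field_simp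
        simp [u₂, χw, hχ_one _ hη1]
      have h0 : ‖iteratedFDeriv ℝ n u₂ ξ‖ = 0 := by
        rw [(hz.iteratedFDeriv ℝ n).eq_of_nhds]
        simp
      rw [← ofReal_norm, h0, ENNReal.ofReal_zero]
      exact bot_le
    · rw [Set.indicator_of_mem (Set.mem_compl hξR), ← ENNReal.ofReal_mul hC'0, ← ofReal_norm]
      refine ENNReal.ofReal_le_ofReal ?_
      have hξ0 : ξ ≠ 0 := by
        rintro rfl
        exact hξR (by simpa using hR0)
      have h := hb₂ n le_rfl ξ hξ0
      rwa [show -(a + 0) - n = -(a + n) by ring] at h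
  have h1' : ‖𝓕 u₁ w‖ ≤ C * (A * 3 ^ (n - a)) * ‖w‖ ^ (-(n - a)) := by
    rw [← ofReal_norm, ENNReal.ofReal_le_ofReal_iff (by positivity)] at h1
    refine h1.trans (le_of_eq ?_)
    rw [Real.mul_rpow (by norm_num) hR0.le, hR, Real.inv_rpow hw'.le, ← Real.rpow_neg hw'.le]
    ring
  have h2' : ‖𝓕 u₂ w‖ ≤ C' * B * ‖w‖ ^ (-(n - a)) := by
    rw [← ofReal_norm, ← ENNReal.ofReal_mul (by positivity),
      ENNReal.ofReal_le_ofReal_iff (by positivity)] at h2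
    have h3 : ‖w‖ ^ n * ‖𝓕 u₂ w‖ ≤ C' * (B * R ^ (-a)) := by
      refine le_trans ?_ h2
      gcongr
      refine le_mul_of_one_le_left hw'.le ?_
      linarith [Real.pi_gt_three]
    rw [← le_div_iff₀' (by positivity)] at h3
    refine h3.trans (le_of_eq ?_)
    rw [hR, Real.inv_rpow hw'.le, ← Real.rpow_neg hw'.le, neg_neg, ← Real.rpow_natCast,
      div_eq_mul_inv, ← Real.rpow_neg hw'.le, show -(n - a) = a + -(n : ℝ) by ring,
      Real.rpow_add hw']
    ring
  rw [hsum, add_mul]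
  exact (norm_add_le _ _).trans (add_le_add h1' h2')

end KernelBound

end Helmholtz
namespace Helmholtz

open scoped LineDeriv

/-! ### The limiting absorption principle. -/

section LimitingAbsorption

theorem norm_log_le (z : ℂ) : ‖Complex.log z‖ ≤ |Real.log ‖z‖| + Real.pi := by
  refine (Complex.norm_le_abs_re_add_abs_im _).trans ?_
  rw [Complex.log_re, Complex.log_im]
  gcongr
  exact Complex.abs_arg_le_pi z

theorem abs_log_le {t : ℝ} (ht : 0 < t) : |Real.log t| ≤ t + t⁻¹ := by
  have h1 := Real.log_le_sub_one_of_pos ht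
  have h2 := Real.log_le_sub_one_of_pos (inv_pos.2 ht)
  rw [Real.log_inv] at h2
  have h3 : 0 < t⁻¹ := inv_pos.2 ht
  rw [abs_le]
  constructor <;> linarith

/-- `z log z - z`, a primitive of the logarithm. -/
noncomputable def logPrimitive (z : ℂ) : ℂ := z * Complex.log z - z

theorem mem_slitPlane_of_im_neg {z : ℂ} (hz : z.im < 0) : z ∈ Complex.slitPlane :=
  Or.inr hz.ne

theorem hasDerivAt_logPrimitive {z : ℂ} (hz : z.im < 0) :
    HasDerivAt logPrimitive (Complex.log z) z := by
  have hz0 : z ≠ 0 := by rintro rfl; simp at hz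
  have h := ((hasDerivAt_id z).mul (Complex.hasDerivAt_log (mem_slitPlane_of_im_neg hz))).sub
    (hasDerivAt_id z)
  convert! h using 1
  simp [hz0]

theorem norm_mul_log_le {z : ℂ} (hz : z ≠ 0) : ‖z‖ * ‖Complex.log z‖ ≤ ‖z‖ ^ 2 + 1 + 4 * ‖z‖ := by
  have hz' : 0 < ‖z‖ := norm_pos_iff.2 hz
  have h1 := (norm_log_le z).trans (add_le_add_left (abs_log_le hz') _)
  calc ‖z‖ * ‖Complex.log z‖ ≤ ‖z‖ * (‖z‖ + ‖z‖⁻¹ + 4) := by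
        gcongr
        linarith [Real.pi_le_four]
    _ = _ := by field_simp

/-- The point `x - iε` of the lower half plane. -/
noncomputable def below (x ε : ℝ) : ℂ := x - Complex.I * ε

theorem below_im (x ε : ℝ) : (below x ε).im = -ε := by simp [below]

theorem below_re (x ε : ℝ) : (below x ε).re = x := by simp [below]

theorem below_ne_zero {x ε : ℝ} (hε : 0 < ε) : below x ε ≠ 0 := by
  intro h
  have := congrArg Complex.im h
  rw [below_im] at this
  simp at this
  exact hε.ne' this

theorem le_norm_below {x ε : ℝ} (hε : 0 < ε) : ε ≤ ‖below x ε‖ := by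
  have := Complex.abs_im_le_norm (below x ε)
  rwa [below_im, abs_neg, abs_of_pos hε] at this

theorem abs_le_norm_below (x ε : ℝ) : |x| ≤ ‖below x ε‖ := by
  have := Complex.abs_re_le_norm (below x ε)
  rwa [below_re] at this

theorem norm_below_le {x ε : ℝ} (hε : 0 < ε) : ‖below x ε‖ ≤ |x| + ε := by
  refine (norm_sub_le _ _).trans ?_
  simp [abs_of_pos hε]

theorem tendsto_below (x : ℝ) : Tendsto (below x) (𝓝[>] 0) (𝓝 (x : ℂ)) := by
  have h : Continuous (below x) := by unfold below; fun_prop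
  have := h.tendsto 0
  simp only [below, Complex.ofReal_zero, mul_zero, sub_zero] at this
  exact this.mono_left nhdsWithin_le_nhds

/-- The approach is from the lower half plane throughout, so a one-sided limit exists even on the
branch cut. -/
theorem exists_tendsto_log_below {x : ℝ} (hx : x ≠ 0) :
    ∃ l, Tendsto (fun ε => Complex.log (below x ε)) (𝓝[>] 0) (𝓝 l) := by
  rcases lt_or_gt_of_ne hx with hx | hx
  · refine ⟨_, (Complex.tendsto_log_nhdsWithin_im_neg_of_re_neg_of_im_zero (z := x)
      (by simpa using hx) (by simp)).comp ?_⟩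
    refine tendsto_nhdsWithin_iff.2 ⟨tendsto_below x, ?_⟩
    filter_upwards [self_mem_nhdsWithin] with ε hε
    simpa [below_im] using hε
  · exact ⟨_, ((continuousAt_clog (Complex.ofReal_mem_slitPlane.2 hx)).tendsto).comp
      (tendsto_below x)⟩

theorem tendsto_div_below (x : ℝ) :
    ∃ l, Tendsto (fun ε => (x : ℂ) * (below x ε)⁻¹) (𝓝[>] 0) (𝓝 l) := by
  rcases eq_or_ne x 0 with rfl | hx
  · exact ⟨0, by simp⟩
  · exact ⟨_, ((tendsto_below x).inv₀ (by simpa using hx)).const_mul _⟩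

theorem tendsto_mul_log_below (x : ℝ) :
    ∃ l, Tendsto (fun ε => (x : ℂ) * Complex.log (below x ε)) (𝓝[>] 0) (𝓝 l) := by
  rcases eq_or_ne x 0 with rfl | hx
  · exact ⟨0, by simp⟩
  · obtain ⟨l, hl⟩ := exists_tendsto_log_below hx
    exact ⟨_, hl.const_mul _⟩

/-- Unlike the logarithm, this primitive also has a limit at `0`, since `z log z → 0`; hence two
integrations by parts are enough. -/
theorem tendsto_logPrimitive_below (x : ℝ) :
    ∃ l, Tendsto (fun ε => logPrimitive (below x ε)) (𝓝[>] 0) (𝓝 l) := by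
  rcases eq_or_ne x 0 with rfl | hx
  · refine ⟨0, ?_⟩
    have hb : ∀ ε : ℝ, 0 < ε → ‖below 0 ε‖ = ε := fun ε hε => by simp [below, abs_of_pos hε]
    have hlim : Tendsto (fun ε : ℝ => |ε * Real.log ε| + Real.pi * ε + ε) (𝓝[>] 0) (𝓝 0) := by
      have hc : Continuous fun ε : ℝ => |ε * Real.log ε| + Real.pi * ε + ε :=
        (Real.continuous_mul_log.abs.add (continuous_const.mul continuous_id)).add continuous_id
      have := hc.tendsto 0
      simp only [zero_mul, abs_zero, mul_zero, add_zero] at this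
      exact this.mono_left nhdsWithin_le_nhds
    refine squeeze_zero_norm' ?_ hlim
    filter_upwards [self_mem_nhdsWithin] with ε hε
    have hε' : 0 < ε := hε
    refine (norm_sub_le _ _).trans ?_
    rw [norm_mul, hb ε hε', abs_mul, abs_of_pos hε']
    have h1 := norm_log_le (below 0 ε)
    rw [hb ε hε'] at h1
    nlinarith
  · obtain ⟨l, hl⟩ := exists_tendsto_log_below hx
    exact ⟨_, ((tendsto_below x).mul hl).sub (tendsto_below x)⟩

variable {E : Type*} [NormedAddCommGroup E] [InnerProductSpace ℝ E]

/-- The weight is taken in `1 + ‖ξ‖²` so that it is smooth and can itself act as a multiplier on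
Schwartz functions. -/
theorem exists_weight_bound {F : E → ℝ} (hF : F.HasTemperateGrowth) :
    ∃ (C : ℝ) (k : ℕ), 1 ≤ C ∧ ∀ ξ, |F ξ| ≤ C * (1 + ‖ξ‖ ^ 2) ^ k := by
  obtain ⟨k, C, hC⟩ := hF.2 0
  refine ⟨max 1 C * 2 ^ k, k, ?_, fun ξ => ?_⟩
  · exact one_le_mul_of_one_le_of_one_le (le_max_left _ _) (one_le_pow₀ one_le_two)
  · have h := hC ξ
    rw [norm_iteratedFDeriv_zero, Real.norm_eq_abs] at h
    have h2 : 1 + ‖ξ‖ ≤ 2 * (1 + ‖ξ‖ ^ 2) := by nlinarith [sq_nonneg (‖ξ‖ - 1)]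
    calc |F ξ| ≤ C * (1 + ‖ξ‖) ^ k := h
      _ ≤ max 1 C * (2 * (1 + ‖ξ‖ ^ 2)) ^ k := by
          gcongr
          exact le_max_right _ _
      _ = _ := by rw [mul_pow]; ring

theorem hasTemperateGrowth_weight (k : ℕ) :
    (fun ξ : E => (((1 + ‖ξ‖ ^ 2) ^ k : ℝ) : ℂ)).HasTemperateGrowth := by
  have h1 : (fun ξ : E => (1 + ‖ξ‖ ^ 2)).HasTemperateGrowth :=
    (Function.HasTemperateGrowth.const 1).add (Function.hasTemperateGrowth_norm_sq E)
  exact Function.Complex.hasTemperateGrowth_ofReal.comp (h1.pow k)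

theorem hasTemperateGrowth_fderiv {F : E → ℝ} (hF : F.HasTemperateGrowth) :
    (fderiv ℝ F).HasTemperateGrowth := by
  refine ⟨hF.1.fderiv_right (by simp), fun n => ?_⟩
  obtain ⟨k, C, h⟩ := hF.2 (n + 1)
  exact ⟨k, C, fun ξ => by rw [norm_iteratedFDeriv_fderiv]; exact h ξ⟩

variable [FiniteDimensional ℝ E] [MeasurableSpace E] [BorelSpace E]

/-- Multiplication by `(1 + |ξ|²)ᵏ`, as a map from Schwartz functions to `L¹`. -/
noncomputable def weightedL1 (E : Type*) [NormedAddCommGroup E] [InnerProductSpace ℝ E]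
    [FiniteDimensional ℝ E] [MeasurableSpace E] [BorelSpace E] (k : ℕ) :
    𝓢(E, ℂ) →L[ℂ] Lp ℂ 1 (volume : Measure E) :=
  (SchwartzMap.toLpCLM ℂ ℂ 1 volume) ∘L
    SchwartzMap.smulLeftCLM ℂ fun ξ : E => (((1 + ‖ξ‖ ^ 2) ^ k : ℝ) : ℂ)

theorem norm_weightedL1 (k : ℕ) (g : 𝓢(E, ℂ)) :
    ‖weightedL1 E k g‖ = ∫ ξ, (1 + ‖ξ‖ ^ 2) ^ k * ‖g ξ‖ := by
  rw [weightedL1, ContinuousLinearMap.comp_apply, SchwartzMap.toLpCLM_apply,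
    L1.norm_eq_integral_norm]
  refine integral_congr_ae ?_
  filter_upwards [SchwartzMap.coeFn_toLp (SchwartzMap.smulLeftCLM ℂ
    (fun ξ : E => (((1 + ‖ξ‖ ^ 2) ^ k : ℝ) : ℂ)) g) 1 (volume : Measure E)] with ξ hξ
  rw [hξ, SchwartzMap.smulLeftCLM_apply_apply (hasTemperateGrowth_weight k), norm_smul,
    Complex.norm_real, Real.norm_of_nonneg (by positivity)]

theorem integrable_weight_mul_norm (k : ℕ) (g : 𝓢(E, ℂ)) :
    Integrable fun ξ => (1 + ‖ξ‖ ^ 2) ^ k * ‖g ξ‖ := by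
  refine ((SchwartzMap.smulLeftCLM ℂ (fun ξ : E => (((1 + ‖ξ‖ ^ 2) ^ k : ℝ) : ℂ))
    g).integrable (μ := volume)).norm.congr (Eventually.of_forall fun ξ => ?_)
  simp only
  rw [SchwartzMap.smulLeftCLM_apply_apply (hasTemperateGrowth_weight k), norm_smul,
    Complex.norm_real, Real.norm_of_nonneg (by positivity)]

theorem integrable_schwartz_mul (g : 𝓢(E, ℂ)) {w : E → ℂ} (hw : AEStronglyMeasurable w)
    {C : ℝ} {k : ℕ} (hC : ∀ ξ, ‖w ξ‖ ≤ C * (1 + ‖ξ‖ ^ 2) ^ k) : Integrable fun ξ => g ξ * w ξ := by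
  refine ((integrable_weight_mul_norm k g).const_mul C).mono'
    (g.continuous.aestronglyMeasurable.mul hw) (Eventually.of_forall fun ξ => ?_)
  rw [norm_mul]
  calc ‖g ξ‖ * ‖w ξ‖ ≤ ‖g ξ‖ * (C * (1 + ‖ξ‖ ^ 2) ^ k) := by gcongr; exact hC ξ
    _ = _ := by ring

theorem norm_integral_schwartz_mul_le (g : 𝓢(E, ℂ)) {w : E → ℂ}
    {C : ℝ} {k : ℕ} (hC : ∀ ξ, ‖w ξ‖ ≤ C * (1 + ‖ξ‖ ^ 2) ^ k) :
    ‖∫ ξ, g ξ * w ξ‖ ≤ C * ‖weightedL1 E k g‖ := by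
  rw [norm_weightedL1, ← integral_const_mul]
  refine norm_integral_le_of_norm_le ((integrable_weight_mul_norm k g).const_mul C)
    (Eventually.of_forall fun ξ => ?_)
  rw [norm_mul]
  calc ‖g ξ‖ * ‖w ξ‖ ≤ ‖g ξ‖ * (C * (1 + ‖ξ‖ ^ 2) ^ k) := by gcongr; exact hC ξ
    _ = _ := by ring

theorem tendsto_integral_schwartz_mul (g : 𝓢(E, ℂ)) {w : ℝ → E → ℂ}
    (hw : ∀ ε, 0 < ε → AEStronglyMeasurable (w ε) volume)
    {C : ℝ} {k : ℕ} (hC : ∀ ε, 0 < ε → ε < 1 → ∀ ξ, ‖w ε ξ‖ ≤ C * (1 + ‖ξ‖ ^ 2) ^ k)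
    (hlim : ∀ ξ, ∃ l, Tendsto (fun ε => w ε ξ) (𝓝[>] 0) (𝓝 l)) :
    ∃ l, Tendsto (fun ε => ∫ ξ, g ξ * w ε ξ) (𝓝[>] 0) (𝓝 l) := by
  choose l hl using hlim
  refine ⟨∫ ξ, g ξ * l ξ, tendsto_integral_filter_of_dominated_convergence
    (fun ξ => C * ((1 + ‖ξ‖ ^ 2) ^ k * ‖g ξ‖)) ?_ ?_ ?_ ?_⟩
  · filter_upwards [self_mem_nhdsWithin] with ε hε
    exact g.continuous.aestronglyMeasurable.mul (hw ε hε)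
  · filter_upwards [Ioo_mem_nhdsGT (zero_lt_one' ℝ)] with ε hε
    refine Eventually.of_forall fun ξ => ?_
    rw [norm_mul]
    calc ‖g ξ‖ * ‖w ε ξ‖ ≤ ‖g ξ‖ * (C * (1 + ‖ξ‖ ^ 2) ^ k) := by
          gcongr; exact hC ε hε.1 hε.2 ξ
      _ = _ := by ring
  · exact (integrable_weight_mul_norm k g).const_mul C
  · exact Eventually.of_forall fun ξ => (hl ξ).const_mul _

/-- The divergence `g ↦ ∑ᵢ ∂ᵢ (Xᵢ g)` of a Schwartz function times a vector field. -/
noncomputable def divergence {ι : Type*} [Fintype ι] (v : ι → E) (X : ι → E → ℂ) :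
    𝓢(E, ℂ) →L[ℂ] 𝓢(E, ℂ) :=
  ∑ i, (LineDeriv.lineDerivOpCLM ℂ 𝓢(E, ℂ) (v i)) ∘L SchwartzMap.smulLeftCLM ℂ (X i)

/-- Multiply the integrand by `1 = ∑ Xᵢ ∂ᵢF + b F`. Since `∂ᵢF · H'(F - iε) = ∂ᵢ(H(F - iε))`, the
first part can be integrated by parts, trading `H'` for the less singular `H`; in the second the
factor `F` compensates the singularity. The bounds assumed on `H` and `H'` only secure
integrability. -/
theorem integral_mul_deriv_comp_below {ι : Type*} [Fintype ι] {F : E → ℝ} (hF : F.HasTemperateGrowth)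
    {v : ι → E} {X : ι → E → ℂ} {b : E → ℂ} (hX : ∀ i, (X i).HasTemperateGrowth)
    (hb : b.HasTemperateGrowth)
    (hXb : ∀ ξ, ∑ i, X i ξ * (fderiv ℝ F ξ (v i) : ℝ) + b ξ * F ξ = 1)
    {ε : ℝ} (hε : 0 < ε) {H H' : ℂ → ℂ} (hH : ∀ z : ℂ, z.im < 0 → HasDerivAt H (H' z) z)
    (hH' : Continuous fun ξ => H' (below (F ξ) ε))
    {C : ℝ} {k : ℕ} (hHb : ∀ ξ, ‖H (below (F ξ) ε)‖ ≤ C * (1 + ‖ξ‖ ^ 2) ^ k)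
    (hHb' : ∀ ξ, ‖H' (below (F ξ) ε)‖ ≤ C * (1 + ‖ξ‖ ^ 2) ^ k) (g : 𝓢(E, ℂ)) :
    ∫ ξ, g ξ * H' (below (F ξ) ε) =
      (∫ ξ, SchwartzMap.smulLeftCLM ℂ b g ξ * (F ξ * H' (below (F ξ) ε))) -
        ∫ ξ, divergence v X g ξ * H (below (F ξ) ε) := by
  have him : ∀ ξ, (below (F ξ) ε).im < 0 := fun ξ => by rw [below_im]; linarith
  have hFd : ∀ ξ, HasFDerivAt F (fderiv ℝ F ξ) ξ := fun ξ =>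
    (hF.1.differentiable (by simp) ξ).hasFDerivAt
  have hbel : ∀ ξ, HasFDerivAt (fun η => below (F η) ε)
      (Complex.ofRealCLM ∘L fderiv ℝ F ξ) ξ := fun ξ =>
    (Complex.ofRealCLM.hasFDerivAt.comp ξ (hFd ξ)).sub_const _
  have hd : ∀ ξ, HasFDerivAt (fun η => H (below (F η) ε))
      (((ContinuousLinearMap.toSpanSingleton ℂ (H' (below (F ξ) ε))).restrictScalars ℝ) ∘L
        (Complex.ofRealCLM ∘L fderiv ℝ F ξ)) ξ := fun ξ =>
    ((hH _ (him ξ)).hasFDerivAt.restrictScalars ℝ).comp ξ (hbel ξ)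
  have hline : ∀ (u : E) ξ, HasLineDerivAt ℝ (fun η => H (below (F η) ε))
      ((fderiv ℝ F ξ u : ℝ) * H' (below (F ξ) ε)) ξ u := fun u ξ => by
    have h := (hd ξ).hasLineDerivAt u
    simpa using h
  have hHc : Continuous fun ξ => H (below (F ξ) ε) :=
    continuous_iff_continuousAt.2 fun ξ => (hd ξ).continuousAt
  obtain ⟨CF, kF, -, hCF⟩ := exists_weight_bound hF
  have hFcont : Continuous F := hF.1.continuous
  have hdF : ∀ u : E, (fun ξ => fderiv ℝ F ξ u).HasTemperateGrowth := fun u =>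
    (ContinuousLinearMap.apply ℝ ℝ u).hasTemperateGrowth.comp (hasTemperateGrowth_fderiv hF)
  have hdFb : ∀ u : E, ∃ (C : ℝ) (k : ℕ), 1 ≤ C ∧ ∀ ξ, |fderiv ℝ F ξ u| ≤ C * (1 + ‖ξ‖ ^ 2) ^ k :=
    fun u => exists_weight_bound (hdF u)
  have hprod : ∀ (G : E → ℝ) (CG : ℝ) (kG : ℕ), (∀ ξ, |G ξ| ≤ CG * (1 + ‖ξ‖ ^ 2) ^ kG) →
      ∀ ξ, ‖(G ξ : ℂ) * H' (below (F ξ) ε)‖ ≤ CG * C * (1 + ‖ξ‖ ^ 2) ^ (kG + k) := by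
    intro G CG kG hG ξ
    rw [norm_mul, Complex.norm_real, Real.norm_eq_abs]
    calc |G ξ| * ‖H' (below (F ξ) ε)‖
        ≤ (CG * (1 + ‖ξ‖ ^ 2) ^ kG) * (C * (1 + ‖ξ‖ ^ 2) ^ k) :=
          mul_le_mul (hG ξ) (hHb' ξ) (norm_nonneg _) ((abs_nonneg _).trans (hG ξ))
      _ = _ := by rw [pow_add]; ring
  have hFint : Integrable fun ξ => SchwartzMap.smulLeftCLM ℂ b g ξ * (F ξ * H' (below (F ξ) ε)) :=
    integrable_schwartz_mul _ ((Complex.continuous_ofReal.comp hFcont).mul hH').aestronglyMeasurable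
      (hprod F CF kF hCF)
  have hXint : ∀ i, Integrable fun ξ => SchwartzMap.smulLeftCLM ℂ (X i) g ξ *
      ((fderiv ℝ F ξ (v i) : ℝ) * H' (below (F ξ) ε)) := fun i => by
    obtain ⟨CX, kX, -, hCX⟩ := hdFb (v i)
    exact integrable_schwartz_mul _
      ((Complex.continuous_ofReal.comp (hdF (v i)).1.continuous).mul hH').aestronglyMeasurable
      (hprod _ CX kX hCX)
  have hibp : ∀ i, ∫ ξ, SchwartzMap.smulLeftCLM ℂ (X i) g ξ *
      ((fderiv ℝ F ξ (v i) : ℝ) * H' (below (F ξ) ε)) =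
      -∫ ξ, (∂_{v i} (SchwartzMap.smulLeftCLM ℂ (X i) g)) ξ * H (below (F ξ) ε) := by
    intro i
    refine integral_bilinear_hasLineDerivAt_right_eq_neg_left_of_integrable (v := v i)
      (B := ContinuousLinearMap.mul ℝ ℂ) ?_ (hXint i) ?_ (fun ξ _ => ?_) (fun ξ _ => hline (v i) ξ)
    · exact integrable_schwartz_mul _ hHc.aestronglyMeasurable hHb
    · exact integrable_schwartz_mul _ hHc.aestronglyMeasurable hHb
    · rw [SchwartzMap.lineDerivOp_apply_eq_fderiv]
      exact (SchwartzMap.hasFDerivAt _ ξ).hasLineDerivAt (v i)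
  have hdiv : ∫ ξ, divergence v X g ξ * H (below (F ξ) ε) =
      ∑ i, ∫ ξ, (∂_{v i} (SchwartzMap.smulLeftCLM ℂ (X i) g)) ξ * H (below (F ξ) ε) := by
    rw [← integral_finsetSum _ fun i _ =>
      integrable_schwartz_mul _ hHc.aestronglyMeasurable hHb]
    refine integral_congr_ae (Eventually.of_forall fun ξ => ?_)
    simp only [divergence, sum_apply, Finset.sum_mul, ContinuousLinearMap.comp_apply]
    rfl
  rw [hdiv, sub_eq_add_neg, ← Finset.sum_neg_distrib, ← Finset.sum_congr rfl fun i _ => hibp i,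
    ← integral_finsetSum _ fun i _ => hXint i,
    ← integral_add hFint (integrable_finsetSum _ fun i _ => hXint i)]
  refine integral_congr_ae (Eventually.of_forall fun ξ => ?_)
  simp only [SchwartzMap.smulLeftCLM_apply_apply hb, SchwartzMap.smulLeftCLM_apply_apply (hX _),
    smul_eq_mul]
  calc g ξ * H' (below (F ξ) ε)
      = (∑ i, X i ξ * (fderiv ℝ F ξ (v i) : ℝ) + b ξ * F ξ) * (g ξ * H' (below (F ξ) ε)) := by
        rw [hXb, one_mul]
    _ = _ := by
        rw [add_mul, Finset.sum_mul, add_comm]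
        congr 1
        · ring
        · exact Finset.sum_congr rfl fun i _ => by ring

/-- **Limiting absorption principle** for a symbol without critical zeros: the functionals
`g ↦ ∫ g / (F - iε)` are equicontinuous on the Schwartz space and converge as `ε → 0⁺`. -/
theorem exists_tendsto_integral_div_below {ι : Type*} [Fintype ι] {F : E → ℝ}
    (hF : F.HasTemperateGrowth)
    {v : ι → E} {X : ι → E → ℂ} {b : E → ℂ} (hX : ∀ i, (X i).HasTemperateGrowth)
    (hb : b.HasTemperateGrowth)
    (hXb : ∀ ξ, ∑ i, X i ξ * (fderiv ℝ F ξ (v i) : ℝ) + b ξ * F ξ = 1) :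
    (∃ P : Seminorm ℂ 𝓢(E, ℂ), Continuous P ∧ ∀ ε : ℝ, 0 < ε → ε < 1 → ∀ g : 𝓢(E, ℂ),
      ‖∫ ξ, g ξ / below (F ξ) ε‖ ≤ P g) ∧
    ∀ g : 𝓢(E, ℂ), ∃ l, Tendsto (fun ε => ∫ ξ, g ξ / below (F ξ) ε) (𝓝[>] 0) (𝓝 l) := by
  obtain ⟨C, k, hC1, hCF⟩ := exists_weight_bound hF
  set A := divergence v X with hA
  set B : 𝓢(E, ℂ) →L[ℂ] 𝓢(E, ℂ) := SchwartzMap.smulLeftCLM ℂ b with hB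
  set W : E → ℝ := fun ξ => C * (1 + ‖ξ‖ ^ 2) ^ k with hW
  have hone : ∀ (ξ : E) (m : ℕ), (1 : ℝ) ≤ (1 + ‖ξ‖ ^ 2) ^ m := fun ξ m =>
    one_le_pow₀ (by nlinarith [sq_nonneg ‖ξ‖])
  have hW1 : ∀ ξ, 1 ≤ W ξ := fun ξ => one_le_mul_of_one_le_of_one_le hC1 (hone ξ k)
  have hW2 : ∀ ξ, W ξ ^ 2 = C ^ 2 * (1 + ‖ξ‖ ^ 2) ^ (2 * k) := fun ξ => by
    rw [hW, mul_pow, ← pow_mul, mul_comm k]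
  have him : ∀ {ε : ℝ}, 0 < ε → ∀ ξ, (below (F ξ) ε).im < 0 := fun hε ξ => by
    rw [below_im]; linarith
  have hFcont : Continuous F := hF.1.continuous
  have hbelc : ∀ ε, Continuous fun ξ => below (F ξ) ε := fun ε =>
    (Complex.continuous_ofReal.comp hFcont).sub continuous_const
  have hinvc : ∀ {ε : ℝ}, 0 < ε → Continuous fun ξ => (below (F ξ) ε)⁻¹ := fun hε =>
    (hbelc _).inv₀ fun ξ => below_ne_zero hε
  have hlogc : ∀ {ε : ℝ}, 0 < ε → Continuous fun ξ => Complex.log (below (F ξ) ε) := fun hε =>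
    (hbelc _).clog fun ξ => mem_slitPlane_of_im_neg (him hε ξ)
  have hLc : ∀ {ε : ℝ}, 0 < ε → Continuous fun ξ => logPrimitive (below (F ξ) ε) := fun hε =>
    ((hbelc _).mul (hlogc hε)).sub (hbelc _)
  have hz : ∀ {ε : ℝ}, 0 < ε → ε < 1 → ∀ ξ, ‖below (F ξ) ε‖ ≤ 2 * W ξ := fun hε hε1 ξ => by
    have := norm_below_le (x := F ξ) hε
    have := hCF ξ
    have := hW1 ξ
    simp only [hW] at *
    linarith
  -- With `‖z‖ ≤ 2W` and `W ≥ 1`, `‖z‖² + 1 + 4‖z‖ ≤ 4W² + 1 + 8W ≤ 13W²`. Adding `‖z‖ ≤ 2W²` for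
  -- the primitive gives the common constant 15.
  have hmul : ∀ {ε : ℝ}, 0 < ε → ε < 1 → ∀ ξ,
      ‖below (F ξ) ε‖ * ‖Complex.log (below (F ξ) ε)‖ ≤ 13 * W ξ ^ 2 := fun {ε} hε hε1 ξ => by
    have h1 := norm_mul_log_le (below_ne_zero (x := F ξ) hε)
    have h2 := hz hε hε1 ξ
    have h3 := hW1 ξ
    nlinarith [norm_nonneg (below (F ξ) ε)]
  have hw0 : ∀ ε, 0 < ε → ε < 1 → ∀ ξ, ‖(F ξ : ℂ) * (below (F ξ) ε)⁻¹‖ ≤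
      15 * C ^ 2 * (1 + ‖ξ‖ ^ 2) ^ (2 * k) := fun ε hε hε1 ξ => by
    rw [mul_assoc, ← hW2, norm_mul, norm_inv, Complex.norm_real, Real.norm_eq_abs,
      ← div_eq_mul_inv]
    have h1 := div_le_one_of_le₀ (abs_le_norm_below (F ξ) ε) (norm_nonneg _)
    nlinarith [hW1 ξ]
  have hw1 : ∀ ε, 0 < ε → ε < 1 → ∀ ξ, ‖(F ξ : ℂ) * Complex.log (below (F ξ) ε)‖ ≤
      15 * C ^ 2 * (1 + ‖ξ‖ ^ 2) ^ (2 * k) := fun ε hε hε1 ξ => by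
    rw [mul_assoc, ← hW2, norm_mul, Complex.norm_real, Real.norm_eq_abs]
    have h1 := mul_le_mul_of_nonneg_right (abs_le_norm_below (F ξ) ε)
      (norm_nonneg (Complex.log (below (F ξ) ε)))
    nlinarith [hmul hε hε1 ξ, hW1 ξ]
  have hw2 : ∀ ε, 0 < ε → ε < 1 → ∀ ξ, ‖logPrimitive (below (F ξ) ε)‖ ≤
      15 * C ^ 2 * (1 + ‖ξ‖ ^ 2) ^ (2 * k) := fun ε hε hε1 ξ => by
    rw [mul_assoc, ← hW2]
    have h1 : ‖logPrimitive (below (F ξ) ε)‖ ≤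
        ‖below (F ξ) ε‖ * ‖Complex.log (below (F ξ) ε)‖ + ‖below (F ξ) ε‖ :=
      (norm_sub_le _ _).trans (by rw [norm_mul])
    nlinarith [hmul hε hε1 ξ, hW1 ξ, hz hε hε1 ξ]
  -- Integration by parts with `H = log`, then with `H = logPrimitive` applied to the divergence `A
  -- g`. Every factor multiplying a Schwartz function on the right is bounded uniformly in `ε`.
  have key : ∀ ε, 0 < ε → ε < 1 → ∀ g : 𝓢(E, ℂ), ∫ ξ, g ξ / below (F ξ) ε =
      (∫ ξ, B g ξ * (F ξ * (below (F ξ) ε)⁻¹)) -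
        ((∫ ξ, B (A g) ξ * (F ξ * Complex.log (below (F ξ) ε))) -
          ∫ ξ, A (A g) ξ * logPrimitive (below (F ξ) ε)) := by
    intro ε hε hε1 g
    -- These bounds may blow up with `ε`: they only justify the integrations by parts at fixed `ε`.
    have hKb : ∀ (M : ℝ) (ξ : E), M ≤ (6 + ε⁻¹) * W ξ ^ 2 →
        M ≤ (15 + ε⁻¹) * C ^ 2 * (1 + ‖ξ‖ ^ 2) ^ (2 * k) := fun M ξ hM => by
      rw [mul_assoc, ← hW2]
      nlinarith [hW1 ξ]
    have hεi : 0 < ε⁻¹ := inv_pos.2 hε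
    have hinvb : ∀ ξ, ‖(below (F ξ) ε)⁻¹‖ ≤ ε⁻¹ := fun ξ => by
      rw [norm_inv]
      exact inv_anti₀ hε (le_norm_below hε)
    have hlogb : ∀ ξ, ‖Complex.log (below (F ξ) ε)‖ ≤
        (15 + ε⁻¹) * C ^ 2 * (1 + ‖ξ‖ ^ 2) ^ (2 * k) := fun ξ => by
      refine hKb _ ξ ?_
      have h1 := norm_log_le (below (F ξ) ε)
      have h2 := abs_log_le (norm_pos_iff.2 (below_ne_zero (x := F ξ) hε))
      have h3 := hinvb ξ
      rw [norm_inv] at h3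
      have h4 := hz hε hε1 ξ
      have h5 : W ξ ≤ W ξ ^ 2 := by nlinarith [hW1 ξ]
      have h6 : 1 ≤ W ξ ^ 2 := by nlinarith [hW1 ξ]
      have h7 : ε⁻¹ ≤ ε⁻¹ * W ξ ^ 2 := le_mul_of_one_le_right hεi.le h6
      nlinarith [Real.pi_le_four]
    have e1 := integral_mul_deriv_comp_below hF hX hb hXb hε (H := Complex.log)
      (H' := fun z => z⁻¹) (fun z hz => Complex.hasDerivAt_log (mem_slitPlane_of_im_neg hz))
      (hinvc hε) (C := (15 + ε⁻¹) * C ^ 2) (k := 2 * k) hlogb (fun ξ => by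
        refine hKb _ ξ ((hinvb ξ).trans ?_)
        have h6 : 1 ≤ W ξ ^ 2 := by nlinarith [hW1 ξ]
        nlinarith) g
    have e2 := integral_mul_deriv_comp_below hF hX hb hXb hε (H := logPrimitive)
      (H' := Complex.log) (fun z hz => hasDerivAt_logPrimitive hz) (hlogc hε)
      (C := (15 + ε⁻¹) * C ^ 2) (k := 2 * k) (fun ξ => by
        refine (hw2 ε hε hε1 ξ).trans ?_
        gcongr
        linarith) hlogb (A g)
    simp only [div_eq_mul_inv]
    rw [e1, e2]
  constructor
  · set Q := weightedL1 E (2 * k)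
    refine ⟨(15 * C ^ 2).toNNReal • ((normSeminorm ℂ (Lp ℂ 1 (volume : Measure E))).comp
      (Q ∘L B).toLinearMap + ((normSeminorm ℂ (Lp ℂ 1 (volume : Measure E))).comp (Q ∘L B ∘L A).toLinearMap +
        (normSeminorm ℂ (Lp ℂ 1 (volume : Measure E))).comp (Q ∘L A ∘L A).toLinearMap)), ?_, fun ε hε hε1 g => ?_⟩
    · have hc : Continuous fun g : 𝓢(E, ℂ) => ((15 * C ^ 2).toNNReal : ℝ) *
          (‖Q (B g)‖ + (‖Q (B (A g))‖ + ‖Q (A (A g))‖)) := by fun_prop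
      exact hc
    · rw [key ε hε hε1 g]
      have hP : ((15 * C ^ 2).toNNReal : ℝ) * (‖Q (B g)‖ + (‖Q (B (A g))‖ + ‖Q (A (A g))‖)) =
          15 * C ^ 2 * ‖Q (B g)‖ + (15 * C ^ 2 * ‖Q (B (A g))‖ + 15 * C ^ 2 * ‖Q (A (A g))‖) := by
        rw [Real.coe_toNNReal _ (by positivity)]
        ring
      refine le_trans ?_ hP.ge
      refine (norm_sub_le _ _).trans (add_le_add ?_ ((norm_sub_le _ _).trans (add_le_add ?_ ?_)))
      · exact norm_integral_schwartz_mul_le (k := 2 * k) _ (hw0 ε hε hε1)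
      · exact norm_integral_schwartz_mul_le (k := 2 * k) _ (hw1 ε hε hε1)
      · exact norm_integral_schwartz_mul_le (k := 2 * k) _ (hw2 ε hε hε1)
  · intro g
    have hFc' : Continuous fun ξ => (F ξ : ℂ) := Complex.continuous_ofReal.comp hFcont
    obtain ⟨l0, hl0⟩ := tendsto_integral_schwartz_mul (B g)
      (w := fun ε ξ => F ξ * (below (F ξ) ε)⁻¹)
      (fun ε hε => (hFc'.mul (hinvc hε)).aestronglyMeasurable) hw0 fun ξ => tendsto_div_below (F ξ)
    obtain ⟨l1, hl1⟩ := tendsto_integral_schwartz_mul (B (A g))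
      (w := fun ε ξ => F ξ * Complex.log (below (F ξ) ε))
      (fun ε hε => (hFc'.mul (hlogc hε)).aestronglyMeasurable) hw1
      fun ξ => tendsto_mul_log_below (F ξ)
    obtain ⟨l2, hl2⟩ := tendsto_integral_schwartz_mul (A (A g))
      (fun ε hε => (hLc hε).aestronglyMeasurable) hw2 fun ξ => tendsto_logPrimitive_below (F ξ)
    refine ⟨l0 - (l1 - l2), (hl0.sub (hl1.sub hl2)).congr' ?_⟩
    filter_upwards [Ioo_mem_nhdsGT (zero_lt_one' ℝ)] with ε hε
    exact (key ε hε.1 hε.2 g).symm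

end LimitingAbsorption

end Helmholtz
namespace Helmholtz

/-! ### Calculus of smooth symbols. -/

section SymbolCalculus

variable {E : Type*} [NormedAddCommGroup E] [NormedSpace ℝ E]

/-- `f` is a smooth symbol of order `s` at infinity. -/
def IsSymbol (s : ℝ) (f : E → ℂ) : Prop :=
  ContDiff ℝ ∞ f ∧ ∀ n, SymbolBound n s f

namespace IsSymbol

variable {s t : ℝ} {f g : E → ℂ}

theorem add (hf : IsSymbol s f) (hg : IsSymbol s g) : IsSymbol s fun ξ => f ξ + g ξ :=
  ⟨hf.1.add hg.1, fun n => (hf.2 n).add (hg.2 n) hf.1 hg.1⟩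

variable [ProperSpace E]

theorem mono (hf : IsSymbol s f) (hst : s ≤ t) : IsSymbol t f :=
  ⟨hf.1, fun n => (hf.2 n).mono_right hst⟩

theorem const (c : ℂ) (hs : 0 ≤ s) : IsSymbol s fun _ : E => c :=
  mono ⟨contDiff_const, fun n => .const n c⟩ hs

theorem clm (L : E →L[ℝ] ℂ) (hs : 1 ≤ s) : IsSymbol s fun ξ => L ξ :=
  mono ⟨L.contDiff, fun n => .clm n L⟩ hs

theorem mul (hf : IsSymbol s f) (hg : IsSymbol t g) : IsSymbol (s + t) fun ξ => f ξ * g ξ :=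
  ⟨hf.1.mul hg.1, fun n => (hf.2 n).mul (hg.2 n) hf.1 hg.1⟩

theorem const_mul (c : ℂ) (hf : IsSymbol s f) : IsSymbol s fun ξ => c * f ξ := by
  simpa using (const (s := 0) c le_rfl).mul hf

theorem sum {ι : Type*} (S : Finset ι) {f : ι → E → ℂ} (hs : 0 ≤ s)
    (hf : ∀ i, IsSymbol s (f i)) : IsSymbol s fun ξ => ∑ i ∈ S, f i ξ := by
  classical
  induction S using Finset.induction_on with
  | empty => simpa using const 0 hs
  | insert i S hi ih => simpa only [Finset.sum_insert hi] using (hf i).add ih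

theorem hasTemperateGrowth (hf : IsSymbol s f) : f.HasTemperateGrowth :=
  SymbolBound.hasTemperateGrowth hf.2 hf.1

end IsSymbol

theorem isSymbol_norm_sq {E : Type*} [NormedAddCommGroup E] [InnerProductSpace ℝ E]
    [FiniteDimensional ℝ E] : IsSymbol 2 fun ξ : E => ((‖ξ‖ ^ 2 : ℝ) : ℂ) := by
  have hd : ∀ ξ : E, HasFDerivAt (fun η : E => ((‖η‖ ^ 2 : ℝ) : ℂ))
      (Complex.ofRealCLM ∘L (2 • innerSL ℝ ξ)) ξ := fun ξ =>
    Complex.ofRealCLM.hasFDerivAt.comp ξ (hasStrictFDerivAt_norm_sq ξ).hasFDerivAt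
  refine ⟨Complex.ofRealCLM.contDiff.comp (contDiff_norm_sq ℝ), fun n => ?_⟩
  suffices SymbolBound (n + 1) 2 fun ξ : E => ((‖ξ‖ ^ 2 : ℝ) : ℂ) from this.mono_left (by omega)
  refine SymbolBound.of_fderiv ?_ ?_
  · refine Asymptotics.IsBigO.of_bound 1 (Eventually.of_forall fun ξ => ?_)
    rw [Complex.norm_real, one_mul, ← Real.rpow_natCast]
    norm_num
  · have h : fderiv ℝ (fun ξ : E => ((‖ξ‖ ^ 2 : ℝ) : ℂ)) = fun ξ =>
        (2 • (ContinuousLinearMap.compL ℝ E ℝ ℂ Complex.ofRealCLM) ∘L (innerSL ℝ : E →L[ℝ] _)) ξ := by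
      funext ξ
      rw [(hd ξ).fderiv]
      ext v
      simp
      rfl
    rw [h, show (2 - 1 : ℝ) = 1 by norm_num]
    exact .clm n _

end SymbolCalculus

/-! ### The quartic symbol, its gradient and ellipticity. -/

section QuarticSymbol

variable {N : ℕ} {α β : ℝ} {V : EuclideanSpace ℝ (Fin N)}

theorem symbol_eq (α β : ℝ) (V ξ : EuclideanSpace ℝ (Fin N)) :
    symbol α β V ξ = (‖ξ‖ ^ 2) ^ 2 - β * ‖ξ‖ ^ 2 + α - inner ℝ V ξ := by
  rw [symbol, profile, real_inner_comm]
  ring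

/-- The gradient of the symbol. -/
noncomputable def symbolGrad (β : ℝ) (V ξ : EuclideanSpace ℝ (Fin N)) : EuclideanSpace ℝ (Fin N) :=
  (4 * ‖ξ‖ ^ 2 - 2 * β) • ξ - V

theorem hasFDerivAt_symbol (ξ : EuclideanSpace ℝ (Fin N)) :
    HasFDerivAt (symbol α β V) (innerSL ℝ (symbolGrad β V ξ)) ξ := by
  have hsq := (hasStrictFDerivAt_norm_sq ξ).hasFDerivAt
  have h := (((hsq.pow 2).sub (hsq.const_mul β)).add_const α).sub
    (innerSL ℝ V).hasFDerivAt
  have hfun : symbol α β V = fun ξ => (‖ξ‖ ^ 2) ^ 2 - β * ‖ξ‖ ^ 2 + α - innerSL ℝ V ξ := by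
    funext ξ
    rw [symbol_eq, innerSL_apply_apply]
  rw [hfun]
  refine h.congr_fderiv ?_
  ext v
  simp [symbolGrad]
  ring

theorem hasTemperateGrowth_symbol : (symbol α β V).HasTemperateGrowth := by
  rw [show symbol α β V = fun ξ => (‖ξ‖ ^ 2) ^ 2 - β * ‖ξ‖ ^ 2 + α - inner ℝ V ξ from
    funext (symbol_eq α β V)]
  have h2 := Function.hasTemperateGrowth_norm_sq (EuclideanSpace ℝ (Fin N))
  exact (((h2.pow 2).sub ((Function.HasTemperateGrowth.const β).mul h2)).add
    (Function.HasTemperateGrowth.const α)).sub (Function.hasTemperateGrowth_inner_right V)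

theorem continuous_symbol : Continuous (symbol α β V) :=
  hasTemperateGrowth_symbol.1.continuous

theorem symbolGrad_ne_zero (hA2 : CondA2 α β V) {ξ : EuclideanSpace ℝ (Fin N)}
    (hξ : symbol α β V ξ = 0) : symbolGrad β V ξ ≠ 0 := by
  have h := hA2 ξ hξ
  have hd : deriv (profile α β) ‖ξ‖ = 4 * ‖ξ‖ ^ 3 - 2 * β * ‖ξ‖ := by
    have h1 : HasDerivAt (profile α β) (4 * ‖ξ‖ ^ 3 - β * (2 * ‖ξ‖)) ‖ξ‖ := by
      have := (((hasDerivAt_id ‖ξ‖).pow 4).sub (((hasDerivAt_id ‖ξ‖).pow 2).const_mul β)).add_const α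
      convert! this using 1
      simp
    rw [h1.deriv]
    ring
  convert! h using 1
  rw [symbolGrad, hd, smul_smul]
  rcases eq_or_ne ξ 0 with rfl | h0
  · simp
  · congr 2
    have : ‖ξ‖ ≠ 0 := norm_ne_zero_iff.2 h0
    field_simp

theorem isSymbol_symbol :
    IsSymbol 4 fun ξ : EuclideanSpace ℝ (Fin N) => (symbol α β V ξ : ℂ) := by
  have h2 := isSymbol_norm_sq (E := EuclideanSpace ℝ (Fin N))
  have h4 : IsSymbol 4 fun ξ : EuclideanSpace ℝ (Fin N) =>
      ((‖ξ‖ ^ 2 : ℝ) : ℂ) * ((‖ξ‖ ^ 2 : ℝ) : ℂ) := (h2.mul h2).mono (by norm_num)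
  have h := ((h4.add ((h2.const_mul (-β)).mono (by norm_num))).add (.const (α : ℂ) (by norm_num))).add
    ((IsSymbol.clm (s := 4) (Complex.ofRealCLM ∘L innerSL ℝ V) (by norm_num)).const_mul (-1))
  convert! h using 2 with ξ
  rw [symbol_eq]
  simp
  ring

theorem isSymbol_symbolGrad (i : Fin N) :
    IsSymbol 3 fun ξ : EuclideanSpace ℝ (Fin N) => (symbolGrad β V ξ i : ℂ) := by
  have h1 : IsSymbol 1 fun ξ : EuclideanSpace ℝ (Fin N) => ((ξ i : ℝ) : ℂ) :=
    .clm (Complex.ofRealCLM ∘L EuclideanSpace.proj i) le_rfl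
  have h2 := (isSymbol_norm_sq (E := EuclideanSpace ℝ (Fin N))).const_mul 4
  have h := (((h2.add (.const (-2 * β : ℂ) (by norm_num))).mul h1).mono
    (t := 3) (by norm_num)).add (.const (-(V i : ℂ)) (by norm_num))
  convert! h using 2 with ξ
  simp [symbolGrad]
  ring

/-- Beyond `2(|β| + |α| + ‖V‖)` the lower-order terms take at most half of the quartic one. This is
the ellipticity behind both reciprocals below. -/
theorem eventually_le_symbol (α β : ℝ) (V : EuclideanSpace ℝ (Fin N)) :
    ∀ᶠ ξ in cocompact (EuclideanSpace ℝ (Fin N)), 2⁻¹ * ‖ξ‖ ^ 4 ≤ symbol α β V ξ := by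
  filter_upwards [eventually_cocompact_le_norm (E := EuclideanSpace ℝ (Fin N)) 1,
    eventually_cocompact_le_norm (E := EuclideanSpace ℝ (Fin N)) (2 * (|β| + |α| + ‖V‖))]
    with ξ h1 h2
  rw [symbol_eq]
  set t := ‖ξ‖
  have hin : inner ℝ V ξ ≤ ‖V‖ * t := real_inner_le_norm V ξ
  have ht2 : 1 ≤ t ^ 2 := one_le_pow₀ h1
  have ht : t ≤ t ^ 2 := by nlinarith
  have e1 : β * t ^ 2 ≤ |β| * t ^ 2 := by gcongr; exact le_abs_self β
  have e2 : -α ≤ |α| * t ^ 2 := by nlinarith [neg_le_abs α, abs_nonneg α]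
  have e3 : ‖V‖ * t ≤ ‖V‖ * t ^ 2 := by gcongr
  have e4 : 2 * (|β| + |α| + ‖V‖) * t ^ 2 ≤ t * t ^ 2 := by gcongr
  have e5 : t * t ^ 2 ≤ t ^ 2 * t ^ 2 := by gcongr
  nlinarith

/-- `F² + |∇F|²`, positive when `F` has no critical zeros. -/
noncomputable def symbolEnergy (α β : ℝ) (V ξ : EuclideanSpace ℝ (Fin N)) : ℂ :=
  (symbol α β V ξ : ℂ) * symbol α β V ξ + ∑ i, (symbolGrad β V ξ i : ℂ) * symbolGrad β V ξ i

theorem symbolEnergy_eq (ξ : EuclideanSpace ℝ (Fin N)) :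
    symbolEnergy α β V ξ = ((symbol α β V ξ ^ 2 + ‖symbolGrad β V ξ‖ ^ 2 : ℝ) : ℂ) := by
  rw [symbolEnergy, EuclideanSpace.real_norm_sq_eq]
  push_cast
  simp only [pow_two]

theorem symbolEnergy_ne_zero (hA2 : CondA2 α β V) (ξ : EuclideanSpace ℝ (Fin N)) :
    symbolEnergy α β V ξ ≠ 0 := by
  rw [symbolEnergy_eq, Complex.ofReal_ne_zero]
  intro h
  have h1 : symbol α β V ξ = 0 := by nlinarith [sq_nonneg ‖symbolGrad β V ξ‖]
  have h2 : ‖symbolGrad β V ξ‖ = 0 := by nlinarith [sq_nonneg (symbol α β V ξ)]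
  exact symbolGrad_ne_zero hA2 h1 (norm_eq_zero.1 h2)

/-- (A2) makes the reciprocal globally smooth; `F² ≥ ‖ξ‖⁸/4` near infinity gives ellipticity of
order 8. -/
theorem isSymbol_inv_symbolEnergy (hA2 : CondA2 α β V) :
    IsSymbol (-8) fun ξ => (symbolEnergy α β V ξ)⁻¹ := by
  have hF := isSymbol_symbol (α := α) (β := β) (V := V)
  have hE : IsSymbol 8 (symbolEnergy α β V) :=
    ((hF.mul hF).mono (t := 8) (by norm_num)).add <| .sum _ (by norm_num) fun i =>
      ((isSymbol_symbolGrad i).mul (isSymbol_symbolGrad i)).mono (by norm_num)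
  have hinv : ContDiff ℝ ∞ fun ξ => (symbolEnergy α β V ξ)⁻¹ :=
    hE.1.inv fun ξ => symbolEnergy_ne_zero hA2 ξ
  refine ⟨hinv, SymbolBound.inv hE.2 hE.1 hinv
    (Eventually.of_forall fun ξ => inv_mul_cancel₀ (symbolEnergy_ne_zero hA2 ξ))
    (c := 4⁻¹) (by norm_num) ?_⟩
  filter_upwards [eventually_le_symbol α β V] with ξ hξ
  rw [symbolEnergy_eq, Complex.norm_real, Real.norm_of_nonneg (by positivity)]
  have h8 : ‖ξ‖ ^ (8 : ℝ) = (‖ξ‖ ^ 4) ^ 2 := by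
    rw [← pow_mul, ← Real.rpow_natCast]; norm_num
  rw [h8]
  have : 0 ≤ ‖ξ‖ ^ 4 := by positivity
  nlinarith [sq_nonneg ‖symbolGrad β V ξ‖]

/-- The required partition `∑ Xᵢ ∂ᵢF + b F = 1` is `|∇F|²/(F² + |∇F|²) + F²/(F² + |∇F|²) = 1`. -/
theorem exists_tendsto_integral_div_symbol (hA2 : CondA2 α β V) :
    (∃ P : Seminorm ℂ 𝓢(EuclideanSpace ℝ (Fin N), ℂ), Continuous P ∧
      ∀ ε : ℝ, 0 < ε → ε < 1 → ∀ g : 𝓢(EuclideanSpace ℝ (Fin N), ℂ),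
        ‖∫ ξ, g ξ / below (symbol α β V ξ) ε‖ ≤ P g) ∧
    ∀ g : 𝓢(EuclideanSpace ℝ (Fin N), ℂ), ∃ l,
      Tendsto (fun ε => ∫ ξ, g ξ / below (symbol α β V ξ) ε) (𝓝[>] 0) (𝓝 l) := by
  have hinv := isSymbol_inv_symbolEnergy hA2
  refine exists_tendsto_integral_div_below (ι := Fin N) hasTemperateGrowth_symbol
    (v := fun i => EuclideanSpace.single i 1)
    (X := fun i ξ => (symbolGrad β V ξ i : ℂ) * (symbolEnergy α β V ξ)⁻¹)
    (b := fun ξ => (symbol α β V ξ : ℂ) * (symbolEnergy α β V ξ)⁻¹)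
    (fun i => ((isSymbol_symbolGrad i).mul hinv).hasTemperateGrowth)
    (isSymbol_symbol.mul hinv).hasTemperateGrowth fun ξ => ?_
  have hne := symbolEnergy_ne_zero hA2 ξ
  have hgrad : ∀ i, fderiv ℝ (symbol α β V) ξ (EuclideanSpace.single i 1) = symbolGrad β V ξ i := by
    intro i
    rw [(hasFDerivAt_symbol ξ).fderiv, innerSL_apply_apply, EuclideanSpace.inner_single_right]
    simp
  simp only [hgrad]
  calc _ = symbolEnergy α β V ξ * (symbolEnergy α β V ξ)⁻¹ := by
        nth_rewrite 3 [symbolEnergy]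
        rw [add_mul, Finset.sum_mul, add_comm]
        congr 1
        · ring
        · exact Finset.sum_congr rfl fun i _ => by ring
    _ = 1 := mul_inv_cancel₀ hne

end QuarticSymbol

/-! ### Existence of the Green function. -/

section GreenFunction

open scoped FourierTransform

variable {N : ℕ} {α β : ℝ} {V : EuclideanSpace ℝ (Fin N)}

/-- The transform `φ ↦ ∫ exp(i x · ξ) φ(x) dx` on Schwartz functions. -/
noncomputable def expTransform (N : ℕ) :
    𝓢(EuclideanSpace ℝ (Fin N), ℂ) →L[ℂ] 𝓢(EuclideanSpace ℝ (Fin N), ℂ) :=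
  (SchwartzMap.compCLMOfContinuousLinearEquiv ℂ (ContinuousLinearEquiv.smulLeft
    (Units.mk0 ((2 * Real.pi)⁻¹ : ℝ) (by positivity)))) ∘L
    (FourierTransform.fourierInvCLM ℂ 𝓢(EuclideanSpace ℝ (Fin N), ℂ))

theorem expTransform_apply (φ : 𝓢(EuclideanSpace ℝ (Fin N), ℂ)) (ξ : EuclideanSpace ℝ (Fin N)) :
    expTransform N φ ξ = ∫ x, Complex.exp (Complex.I * (inner ℝ x ξ : ℝ)) * φ x := by
  have h : expTransform N φ ξ = 𝓕⁻ (φ : EuclideanSpace ℝ (Fin N) → ℂ) ((2 * Real.pi)⁻¹ • ξ) := by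
    rw [← SchwartzMap.fourierInv_coe]
    rfl
  rw [h, Real.fourierInv_eq']
  refine integral_congr_ae (Eventually.of_forall fun x => ?_)
  simp only [smul_eq_mul]
  rw [inner_smul_right, mul_comm Complex.I]
  congr 4
  have := Real.pi_ne_zero
  field_simp

theorem approxGreen_eq (ε : ℝ) (φ : 𝓢(EuclideanSpace ℝ (Fin N), ℂ)) :
    approxGreen α β V ε φ = ((2 * Real.pi) ^ N : ℝ)⁻¹ *
      ∫ ξ, expTransform N φ ξ / below (symbol α β V ξ) ε := by
  simp only [approxGreen, expTransform_apply, below]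

/-- Uniformity in `ε` serves twice: for the continuity of the limit functional, and for dominated
convergence in the convolution `ψ * G`. -/
theorem exists_seminorm_approxGreen_le (hA2 : CondA2 α β V) :
    ∃ P : Seminorm ℂ 𝓢(EuclideanSpace ℝ (Fin N), ℂ), Continuous P ∧
      ∀ ε : ℝ, 0 < ε → ε < 1 → ∀ φ, ‖approxGreen α β V ε φ‖ ≤ P φ := by
  obtain ⟨P, hP, hPb⟩ := (exists_tendsto_integral_div_symbol hA2).1
  refine ⟨(((2 * Real.pi) ^ N : ℝ)⁻¹).toNNReal • P.comp (expTransform N).toLinearMap, ?_,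
    fun ε hε hε1 φ => ?_⟩
  · have hc : Continuous fun φ => ((((2 * Real.pi) ^ N : ℝ)⁻¹).toNNReal : ℝ) *
        P (expTransform N φ) := continuous_const.mul (hP.comp (expTransform N).continuous)
    exact hc
  · have h : ((((2 * Real.pi) ^ N : ℝ)⁻¹).toNNReal : ℝ) * P (expTransform N φ) =
        ((2 * Real.pi) ^ N : ℝ)⁻¹ * P (expTransform N φ) := by
      rw [Real.coe_toNNReal _ (by positivity)]
    refine le_trans ?_ h.ge
    rw [approxGreen_eq, norm_mul]
    rw [Complex.norm_real, Real.norm_of_nonneg (by positivity)]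
    gcongr
    exact hPb ε hε hε1 _

theorem integrable_expTransform_div {ε : ℝ} (hε : 0 < ε)
    (φ : 𝓢(EuclideanSpace ℝ (Fin N), ℂ)) :
    Integrable fun ξ => φ ξ / below (symbol α β V ξ) ε := by
  simp only [div_eq_mul_inv]
  have hc : Continuous fun ξ => (below (symbol α β V ξ) ε)⁻¹ :=
    ((Complex.continuous_ofReal.comp continuous_symbol).sub continuous_const).inv₀
      fun ξ => below_ne_zero hε
  refine integrable_schwartz_mul φ hc.aestronglyMeasurable (C := ε⁻¹) (k := 0) fun ξ => ?_
  rw [pow_zero, mul_one, norm_inv]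
  exact inv_anti₀ hε (le_norm_below hε)

theorem exists_isGreenFunction (hA2 : CondA2 α β V) :
    ∃ G : 𝓢'(EuclideanSpace ℝ (Fin N), ℂ), IsGreenFunction α β V G := by
  obtain ⟨P, hP, hPb⟩ := exists_seminorm_approxGreen_le hA2
  have hlim : ∀ φ : 𝓢(EuclideanSpace ℝ (Fin N), ℂ), ∃ l,
      Tendsto (fun ε => approxGreen α β V ε φ) (𝓝[>] 0) (𝓝 l) := fun φ => by
    obtain ⟨l, hl⟩ := (exists_tendsto_integral_div_symbol hA2).2 (expTransform N φ)
    simp only [approxGreen_eq]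
    exact ⟨_, hl.const_mul _⟩
  choose L hL using hlim
  let G : 𝓢(EuclideanSpace ℝ (Fin N), ℂ) →ₗ[ℂ] ℂ :=
    { toFun := L
      map_add' := fun φ χ => by
        refine tendsto_nhds_unique (hL (φ + χ)) (((hL φ).add (hL χ)).congr' ?_)
        filter_upwards [self_mem_nhdsWithin] with ε hε
        simp only [approxGreen_eq, map_add, add_apply, add_div]
        rw [integral_add (integrable_expTransform_div hε _) (integrable_expTransform_div hε _),
          mul_add]
      map_smul' := fun c φ => by
        refine tendsto_nhds_unique (hL (c • φ)) (((hL φ).const_mul c).congr fun ε => ?_)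
        simp only [approxGreen_eq, map_smul, smul_apply, smul_eq_mul, mul_div_assoc]
        rw [integral_const_mul]
        ring }
  have hGP : ∀ φ, ‖G φ‖ ≤ P φ := fun φ => by
    refine le_of_tendsto (hL φ).norm ?_
    filter_upwards [Ioo_mem_nhdsGT (zero_lt_one' ℝ)] with ε hε using hPb ε hε.1 hε.2 φ
  have hGc : Continuous G := by
    refine continuous_of_continuousAt_zero G ?_
    rw [ContinuousAt, map_zero]
    refine squeeze_zero_norm hGP ?_
    simpa using hP.tendsto 0
  exact ⟨ContinuousLinearMap.toPointwiseConvergenceCLM _ _ _ _ ⟨G, hGc⟩, fun φ => hL φ⟩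

end GreenFunction

end Helmholtz
namespace Helmholtz

/-! ### Convolution with `G₁` as a Fourier multiplier. -/

section Convolution

variable {N : ℕ} {α β : ℝ} {V : EuclideanSpace ℝ (Fin N)}

theorem norm_exp_I_mul (r : ℝ) : ‖Complex.exp (Complex.I * r)‖ = 1 := by
  rw [mul_comm, Complex.norm_exp_ofReal_mul_I]

/-- The transform `hat` as a map on Schwartz functions. -/
noncomputable def hatMap (N : ℕ) :
    𝓢(EuclideanSpace ℝ (Fin N), ℂ) →L[ℂ] 𝓢(EuclideanSpace ℝ (Fin N), ℂ) :=
  (SchwartzMap.compCLMOfContinuousLinearEquiv ℂ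
    (ContinuousLinearEquiv.neg ℝ (M := EuclideanSpace ℝ (Fin N)))) ∘L expTransform N

theorem hatMap_apply (f : 𝓢(EuclideanSpace ℝ (Fin N), ℂ)) (ξ : EuclideanSpace ℝ (Fin N)) :
    hatMap N f ξ = hat (fun x => f x) ξ := by
  have h : hatMap N f ξ = expTransform N f (-ξ) := rfl
  rw [h, expTransform_apply, hat]
  simp only [inner_neg_right, Complex.ofReal_neg, mul_neg]

theorem expTransform_reflectAt (f : 𝓢(EuclideanSpace ℝ (Fin N), ℂ))
    (x ξ : EuclideanSpace ℝ (Fin N)) :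
    expTransform N (reflectAt f x) ξ =
      Complex.exp (Complex.I * (inner ℝ x ξ : ℝ)) * hatMap N f ξ := by
  rw [expTransform_apply, hatMap_apply, hat, ← integral_const_mul,
    ← integral_sub_left_eq_self _ volume x]
  refine integral_congr_ae (Eventually.of_forall fun y => ?_)
  simp only [reflectAt_apply]
  rw [← mul_assoc, ← Complex.exp_add, inner_sub_left]
  congr 2
  · push_cast
    ring
  · rw [sub_sub_cancel]

/-- From `‖x‖ ≤ (1 + ‖y‖)(1 + ‖x - y‖)`, translating by `y` costs at most a power of `1 + ‖y‖`. So
`ψ * G_ε` grows at most polynomially, uniformly in `ε`. -/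
theorem exists_seminorm_reflectAt_le {P : Seminorm ℂ 𝓢(EuclideanSpace ℝ (Fin N), ℂ)}
    (hP : Continuous P) (ψ : 𝓢(EuclideanSpace ℝ (Fin N), ℂ)) :
    ∃ (C : ℝ) (k : ℕ), 0 ≤ C ∧ ∀ y, P (reflectAt ψ y) ≤ C * (1 + ‖y‖) ^ k := by
  obtain ⟨s, C, -, hC⟩ := Seminorm.bound_of_continuous
    (schwartz_withSeminorms ℂ (EuclideanSpace ℝ (Fin N)) ℂ) P hP
  set φ : 𝓢(EuclideanSpace ℝ (Fin N), ℂ) := SchwartzMap.compCLMOfContinuousLinearEquiv ℂ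
      (ContinuousLinearEquiv.neg ℝ (M := EuclideanSpace ℝ (Fin N))) ψ with hφ
  have hs : ∀ i : ℕ × ℕ, ∃ D : ℝ, 0 ≤ D ∧ ∀ y,
      schwartzSeminormFamily ℂ (EuclideanSpace ℝ (Fin N)) ℂ i (reflectAt ψ y) ≤
        D * (1 + ‖y‖) ^ i.1 := by
    intro i
    set D := 2 ^ i.1 * ((Finset.Iic i).sup fun m => SchwartzMap.seminorm ℂ m.1 m.2) φ
    have hD : 0 ≤ D := mul_nonneg (by positivity) (apply_nonneg _ _)
    refine ⟨D, hD, fun y => ?_⟩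
    refine SchwartzMap.seminorm_le_bound ℂ i.1 i.2 _ (by positivity) fun x => ?_
    have h1 : iteratedFDeriv ℝ i.2 (reflectAt ψ y) x = iteratedFDeriv ℝ i.2 φ (x - y) := by
      have : (reflectAt ψ y : EuclideanSpace ℝ (Fin N) → ℂ) = fun z => φ (z - y) := by
        funext z
        simp [reflectAt, hφ]
      rw [this, iteratedFDeriv_comp_sub]
    have h2 := SchwartzMap.one_add_le_sup_seminorm_apply (𝕜 := ℂ) (m := i) le_rfl le_rfl φ (x - y)
    have h3 : ‖x‖ ≤ (1 + ‖y‖) * (1 + ‖x - y‖) := by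
      have := norm_add_le (x - y) y
      rw [sub_add_cancel] at this
      nlinarith [norm_nonneg y, norm_nonneg (x - y), mul_nonneg (norm_nonneg y) (norm_nonneg (x - y))]
    rw [h1]
    calc ‖x‖ ^ i.1 * ‖iteratedFDeriv ℝ i.2 φ (x - y)‖
        ≤ ((1 + ‖y‖) * (1 + ‖x - y‖)) ^ i.1 * ‖iteratedFDeriv ℝ i.2 φ (x - y)‖ := by gcongr
      _ = (1 + ‖y‖) ^ i.1 * ((1 + ‖x - y‖) ^ i.1 * ‖iteratedFDeriv ℝ i.2 φ (x - y)‖) := by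
          rw [mul_pow]; ring
      _ ≤ (1 + ‖y‖) ^ i.1 * D := by gcongr
      _ = _ := mul_comm _ _
  choose D hD0 hD using hs
  refine ⟨C * ∑ i ∈ s, D i, s.sup Prod.fst, mul_nonneg C.2 (Finset.sum_nonneg fun i _ => hD0 i),
    fun y => (hC _).trans ?_⟩
  have h1 : s.sup (schwartzSeminormFamily ℂ (EuclideanSpace ℝ (Fin N)) ℂ) (reflectAt ψ y) ≤
      (∑ i ∈ s, D i) * (1 + ‖y‖) ^ s.sup Prod.fst := by
    refine Seminorm.finset_sup_apply_le (mul_nonneg (Finset.sum_nonneg fun i _ => hD0 i)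
      (by positivity)) fun i hi => (hD i y).trans ?_
    have h2 : D i ≤ ∑ i ∈ s, D i := Finset.single_le_sum (fun i _ => hD0 i) hi
    have h3 : (1 + ‖y‖) ^ i.1 ≤ (1 + ‖y‖) ^ s.sup Prod.fst :=
      pow_le_pow_right₀ (by simp) (Finset.le_sup (f := Prod.fst) hi)
    have h4 := hD0 i
    have h5 : 0 ≤ ∑ i ∈ s, D i := Finset.sum_nonneg fun i _ => hD0 i
    gcongr
  have h4 : 0 ≤ ∑ i ∈ s, D i := Finset.sum_nonneg fun i _ => hD0 i
  calc (C • s.sup (schwartzSeminormFamily ℂ (EuclideanSpace ℝ (Fin N)) ℂ)) (reflectAt ψ y)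
      = C * s.sup (schwartzSeminormFamily ℂ (EuclideanSpace ℝ (Fin N)) ℂ) (reflectAt ψ y) := rfl
    _ ≤ C * ((∑ i ∈ s, D i) * (1 + ‖y‖) ^ s.sup Prod.fst) := by gcongr
    _ = _ := by ring

theorem continuous_inv_below {ε : ℝ} (hε : 0 < ε) :
    Continuous fun ξ => (below (symbol α β V ξ) ε)⁻¹ :=
  ((Complex.continuous_ofReal.comp continuous_symbol).sub continuous_const).inv₀
    fun _ => below_ne_zero hε

theorem continuous_exp_I_inner (x : EuclideanSpace ℝ (Fin N)) :
    Continuous fun ξ : EuclideanSpace ℝ (Fin N) =>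
      Complex.exp (Complex.I * (inner ℝ x ξ : ℝ)) := by fun_prop

theorem approxGreen_reflectAt (ε : ℝ) (f : 𝓢(EuclideanSpace ℝ (Fin N), ℂ))
    (x : EuclideanSpace ℝ (Fin N)) :
    approxGreen α β V ε (reflectAt f x) = ((2 * Real.pi) ^ N : ℝ)⁻¹ *
      ∫ ξ, Complex.exp (Complex.I * (inner ℝ x ξ : ℝ)) * hatMap N f ξ *
        (below (symbol α β V ξ) ε)⁻¹ := by
  simp only [approxGreen_eq, expTransform_reflectAt, div_eq_mul_inv]

/-- The action of `G_ε` commutes with the convolution of two Schwartz functions. -/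
theorem integral_approxGreen_reflectAt {ε : ℝ} (hε : 0 < ε)
    (ψ f : 𝓢(EuclideanSpace ℝ (Fin N), ℂ)) (x : EuclideanSpace ℝ (Fin N)) :
    Integrable (fun y => approxGreen α β V ε (reflectAt ψ y) * reflectAt f x y) ∧
    ∫ y, approxGreen α β V ε (reflectAt ψ y) * reflectAt f x y = ((2 * Real.pi) ^ N : ℝ)⁻¹ *
      ∫ ξ, Complex.exp (Complex.I * (inner ℝ x ξ : ℝ)) * (hatMap N ψ ξ * hatMap N f ξ) *
        (below (symbol α β V ξ) ε)⁻¹ := by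
  set u : EuclideanSpace ℝ (Fin N) → ℂ := fun ξ => hatMap N ψ ξ * (below (symbol α β V ξ) ε)⁻¹
  have hu : Integrable u := by
    simpa only [div_eq_mul_inv] using integrable_expTransform_div (α := α) (β := β) (V := V) hε
      (hatMap N ψ)
  set w : EuclideanSpace ℝ (Fin N) × EuclideanSpace ℝ (Fin N) → ℂ := fun z =>
    Complex.exp (Complex.I * (inner ℝ z.1 z.2 : ℝ)) * (reflectAt f x z.1 * u z.2)
  have hw : Integrable w (volume.prod volume) := by
    refine (((reflectAt f x).integrable (μ := volume)).mul_prod hu).bdd_mul (c := 1) ?_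
      (Eventually.of_forall fun z => (norm_exp_I_mul _).le)
    exact Continuous.aestronglyMeasurable (by fun_prop)
  have hinner : ∀ y, ∫ ξ, w (y, ξ) = (∫ ξ, Complex.exp (Complex.I * (inner ℝ y ξ : ℝ)) *
      hatMap N ψ ξ * (below (symbol α β V ξ) ε)⁻¹) * reflectAt f x y := by
    intro y
    rw [← integral_mul_const]
    refine integral_congr_ae (Eventually.of_forall fun ξ => ?_)
    simp only [w, u]
    ring
  have heq : ∀ y, approxGreen α β V ε (reflectAt ψ y) * reflectAt f x y =
      ((2 * Real.pi) ^ N : ℝ)⁻¹ * ∫ ξ, w (y, ξ) := by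
    intro y
    rw [hinner, approxGreen_reflectAt, mul_assoc]
  simp only [heq]
  refine ⟨hw.integral_prod_left.const_mul _, ?_⟩
  rw [integral_const_mul, integral_integral_swap hw]
  congr 1
  refine integral_congr_ae (Eventually.of_forall fun ξ => ?_)
  simp only [w]
  have h := expTransform_reflectAt f x ξ
  rw [expTransform_apply] at h
  calc ∫ y, Complex.exp (Complex.I * (inner ℝ y ξ : ℝ)) * (reflectAt f x y * u ξ)
      = (∫ y, Complex.exp (Complex.I * (inner ℝ y ξ : ℝ)) * reflectAt f x y) * u ξ := by
        rw [← integral_mul_const]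
        simp only [mul_assoc]
    _ = _ := by
        rw [h]
        simp only [u]
        ring

/-- The Fourier multiplier `(1 - ψ̂) / F` of the non-resonant part of the resolvent. -/
noncomputable def awayMultiplier (α β : ℝ) (V : EuclideanSpace ℝ (Fin N))
    (ψ : 𝓢(EuclideanSpace ℝ (Fin N), ℂ)) (ξ : EuclideanSpace ℝ (Fin N)) : ℂ :=
  (1 - hatMap N ψ ξ) * (symbol α β V ξ : ℂ)⁻¹

variable {c₁ : ℝ} {ψ : 𝓢(EuclideanSpace ℝ (Fin N), ℂ)}

theorem hatMap_eq_one_of_symbol_eq_zero (hc₁ : 0 < c₁) (hψ : IsCutoff α β V c₁ ψ)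
    {ξ : EuclideanSpace ℝ (Fin N)} (hξ : symbol α β V ξ = 0) : ∀ᶠ η in 𝓝 ξ, hatMap N ψ η = 1 := by
  filter_upwards [Metric.ball_mem_nhds ξ hc₁] with η hη
  rw [hatMap_apply]
  refine hψ.eq_one η ((Metric.infDist_le_dist_of_mem (x := η) (y := ξ) hξ).trans ?_)
  exact (Metric.mem_ball.1 hη).le

/-- Near a zero of `F` the numerator vanishes identically, and elsewhere division is harmless, so
the multiplier is smooth. Near infinity `ψ̂ = 0` and it equals `1/F`, the reciprocal of an elliptic
symbol of order 4. -/
theorem isSymbol_awayMultiplier (hc₁ : 0 < c₁) (hψ : IsCutoff α β V c₁ ψ) :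
    IsSymbol (-4) (awayMultiplier α β V ψ) := by
  have hF := isSymbol_symbol (α := α) (β := β) (V := V)
  have hsmooth : ContDiff ℝ ∞ (awayMultiplier α β V ψ) := by
    refine contDiff_iff_contDiffAt.2 fun ξ => ?_
    by_cases hξ : symbol α β V ξ = 0
    · refine (contDiffAt_const (c := (0 : ℂ))).congr_of_eventuallyEq ?_
      filter_upwards [hatMap_eq_one_of_symbol_eq_zero hc₁ hψ hξ] with η hη
      simp [awayMultiplier, hη]
    · exact ((contDiff_const.sub ((hatMap N ψ).smooth ⊤)).contDiffAt).mul
        (hF.1.contDiffAt.inv (by simpa using hξ))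
  refine ⟨hsmooth, SymbolBound.inv hF.2 hF.1 hsmooth ?_ (c := 2⁻¹) (by norm_num) ?_⟩
  · have hcpt : ∀ᶠ ξ in cocompact (EuclideanSpace ℝ (Fin N)), hatMap N ψ ξ = 0 := by
      filter_upwards [hψ.compact_support.compl_mem_cocompact] with ξ hξ
      rw [hatMap_apply]
      exact image_eq_zero_of_notMem_tsupport hξ
    filter_upwards [hcpt, eventually_le_symbol α β V,
      eventually_cocompact_le_norm (E := EuclideanSpace ℝ (Fin N)) 1] with ξ h1 h2 h3
    have : 0 < symbol α β V ξ := lt_of_lt_of_le (by positivity) h2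
    have hne : (symbol α β V ξ : ℂ) ≠ 0 := by exact_mod_cast this.ne'
    simp [awayMultiplier, h1, hne]
  · filter_upwards [eventually_le_symbol α β V] with ξ hξ
    rw [Complex.norm_real, Real.norm_eq_abs, show (4 : ℝ) = (4 : ℕ) by norm_num, Real.rpow_natCast]
    exact hξ.trans (le_abs_self _)

/-- The operator with multiplier `(1 - ψ̂) / F` on Schwartz functions. -/
noncomputable def awayOperator (α β : ℝ) (V : EuclideanSpace ℝ (Fin N))
    (ψ : 𝓢(EuclideanSpace ℝ (Fin N), ℂ)) :
    𝓢(EuclideanSpace ℝ (Fin N), ℂ) →L[ℂ] 𝓢(EuclideanSpace ℝ (Fin N), ℂ) :=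
  ((((2 * Real.pi) ^ N : ℝ)⁻¹ : ℝ) : ℂ) •
    (expTransform N ∘L SchwartzMap.smulLeftCLM ℂ (awayMultiplier α β V ψ) ∘L hatMap N)

theorem awayOperator_apply (hc₁ : 0 < c₁) (hψ : IsCutoff α β V c₁ ψ)
    (f : 𝓢(EuclideanSpace ℝ (Fin N), ℂ)) (x : EuclideanSpace ℝ (Fin N)) :
    awayOperator α β V ψ f x = ((2 * Real.pi) ^ N : ℝ)⁻¹ *
      ∫ ξ, Complex.exp (Complex.I * (inner ℝ x ξ : ℝ)) * hatMap N f ξ *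
        awayMultiplier α β V ψ ξ := by
  have h : awayOperator α β V ψ f x = ((((2 * Real.pi) ^ N : ℝ)⁻¹ : ℝ) : ℂ) * expTransform N
    (SchwartzMap.smulLeftCLM ℂ (awayMultiplier α β V ψ) (hatMap N f)) x := rfl
  rw [h, expTransform_apply]
  congr 1
  refine integral_congr_ae (Eventually.of_forall fun ξ => ?_)
  simp only [SchwartzMap.smulLeftCLM_apply_apply
    (isSymbol_awayMultiplier hc₁ hψ).hasTemperateGrowth, smul_eq_mul, real_inner_comm x ξ]
  ring

theorem exists_norm_awayMultiplier_le (hc₁ : 0 < c₁) (hψ : IsCutoff α β V c₁ ψ) :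
    ∃ C : ℝ, 0 ≤ C ∧ ∀ ξ, ‖awayMultiplier α β V ψ ξ‖ ≤ C := by
  obtain ⟨C, hC0, hC⟩ := ((isSymbol_awayMultiplier hc₁ hψ).mono (t := 0) (by norm_num)).2 0
    |>.exists_bound (isSymbol_awayMultiplier hc₁ hψ).1
  refine ⟨C, hC0, fun ξ => ?_⟩
  simpa using hC 0 le_rfl ξ

theorem integrable_exp_mul_schwartz_mul (x : EuclideanSpace ℝ (Fin N))
    (g : 𝓢(EuclideanSpace ℝ (Fin N), ℂ)) {w : EuclideanSpace ℝ (Fin N) → ℂ} (hw : Continuous w)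
    {C : ℝ} (hC : ∀ ξ, ‖w ξ‖ ≤ C) :
    Integrable fun ξ => Complex.exp (Complex.I * (inner ℝ x ξ : ℝ)) * g ξ * w ξ := by
  have h := integrable_schwartz_mul g
    (w := fun ξ => Complex.exp (Complex.I * (inner ℝ x ξ : ℝ)) * w ξ)
    ((continuous_exp_I_inner x).mul hw).aestronglyMeasurable (C := C) (k := 0) fun ξ => by
      rw [norm_mul, norm_exp_I_mul, one_mul, pow_zero, mul_one]
      exact hC ξ
  refine h.congr (Eventually.of_forall fun ξ => ?_)
  simp only
  ring

/-- `G₁ * f` is given by the Fourier multiplier `(1 - ψ̂) / F`. -/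
theorem resolventAway_eq (hA2 : CondA2 α β V) {G : 𝓢'(EuclideanSpace ℝ (Fin N), ℂ)}
    (hG : IsGreenFunction α β V G) (hc₁ : 0 < c₁) (hψ : IsCutoff α β V c₁ ψ)
    (f : 𝓢(EuclideanSpace ℝ (Fin N), ℂ)) (x : EuclideanSpace ℝ (Fin N)) :
    resolventAway G ψ f x = awayOperator α β V ψ f x := by
  rw [awayOperator_apply hc₁ hψ]
  obtain ⟨P, hP, hPb⟩ := exists_seminorm_approxGreen_le hA2
  obtain ⟨C, k, hC0, hC⟩ := exists_seminorm_reflectAt_le hP ψ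
  -- The limit `ε → 0` enters the integral against `ψ * G_ε` because that function is polynomially
  -- bounded uniformly in `ε` and `f` decays rapidly.
  have h1 : Tendsto (fun ε => approxGreen α β V ε (reflectAt f x) -
      ∫ y, approxGreen α β V ε (reflectAt ψ y) * reflectAt f x y) (𝓝[>] 0)
      (𝓝 (resolventAway G ψ f x)) := by
    refine (hG (reflectAt f x)).sub ?_
    refine tendsto_integral_filter_of_dominated_convergence
      (fun y => C * 2 ^ k * ((1 + ‖y‖ ^ 2) ^ k * ‖reflectAt f x y‖)) ?_ ?_ ?_ ?_
    · filter_upwards [self_mem_nhdsWithin] with ε hε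
      exact (integral_approxGreen_reflectAt hε ψ f x).1.aestronglyMeasurable
    · filter_upwards [Ioo_mem_nhdsGT (zero_lt_one' ℝ)] with ε hε
      refine Eventually.of_forall fun y => ?_
      have h2 : 1 + ‖y‖ ≤ 2 * (1 + ‖y‖ ^ 2) := by nlinarith [sq_nonneg (‖y‖ - 1)]
      rw [norm_mul]
      calc ‖approxGreen α β V ε (reflectAt ψ y)‖ * ‖reflectAt f x y‖
          ≤ (C * (2 * (1 + ‖y‖ ^ 2)) ^ k) * ‖reflectAt f x y‖ := by
            gcongr
            refine (hPb ε hε.1 hε.2 _).trans ((hC y).trans ?_)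
            gcongr
        _ = _ := by rw [mul_pow]; ring
    · exact (integrable_weight_mul_norm k _).const_mul _
    · exact Eventually.of_forall fun y => (hG (reflectAt ψ y)).mul_const _
  have h2 : ∀ ε : ℝ, 0 < ε → approxGreen α β V ε (reflectAt f x) -
      ∫ y, approxGreen α β V ε (reflectAt ψ y) * reflectAt f x y = ((2 * Real.pi) ^ N : ℝ)⁻¹ *
      ∫ ξ, Complex.exp (Complex.I * (inner ℝ x ξ : ℝ)) * hatMap N f ξ *
        ((1 - hatMap N ψ ξ) * (below (symbol α β V ξ) ε)⁻¹) := by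
    intro ε hε
    have hb : ∀ ξ, ‖(below (symbol α β V ξ) ε)⁻¹‖ ≤ ε⁻¹ := fun ξ => by
      rw [norm_inv]
      exact inv_anti₀ hε (le_norm_below hε)
    have hb' : ∀ ξ, ‖hatMap N ψ ξ * (below (symbol α β V ξ) ε)⁻¹‖ ≤ ε⁻¹ := fun ξ => by
      obtain ⟨r, hr0, hr1, hr⟩ := hψ.mem_unit ξ
      rw [hatMap_apply, hr, norm_mul, Complex.norm_real, Real.norm_of_nonneg hr0]
      exact (mul_le_of_le_one_left (norm_nonneg _) hr1).trans (hb ξ)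
    have i1 := integrable_exp_mul_schwartz_mul x (hatMap N f)
      (continuous_inv_below (α := α) (β := β) (V := V) hε) hb
    have i2 := integrable_exp_mul_schwartz_mul x (hatMap N f)
      (w := fun ξ => hatMap N ψ ξ * (below (symbol α β V ξ) ε)⁻¹)
      ((hatMap N ψ).continuous.mul (continuous_inv_below (α := α) (β := β) (V := V) hε)) hb'
    have e2 : ∀ ξ, Complex.exp (Complex.I * (inner ℝ x ξ : ℝ)) * (hatMap N ψ ξ * hatMap N f ξ) *
        (below (symbol α β V ξ) ε)⁻¹ = Complex.exp (Complex.I * (inner ℝ x ξ : ℝ)) * hatMap N f ξ *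
        (hatMap N ψ ξ * (below (symbol α β V ξ) ε)⁻¹) := fun ξ => by ring
    rw [approxGreen_reflectAt, (integral_approxGreen_reflectAt hε ψ f x).2,
      integral_congr_ae (Eventually.of_forall e2), ← mul_sub, ← integral_sub i1 i2]
    congr 1
    refine integral_congr_ae (Eventually.of_forall fun ξ => ?_)
    simp only
    ring
  refine tendsto_nhds_unique h1 (Tendsto.congr' (EventuallyEq.symm (by
    filter_upwards [self_mem_nhdsWithin] with ε hε using h2 ε hε)) ?_)
  -- On the frequency side `|F - iε| ≥ |F|`, and the numerator is zero where `F` is, so the limiting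
  -- multiplier itself supplies the domination.
  obtain ⟨K, hK0, hK⟩ := exists_norm_awayMultiplier_le hc₁ hψ
  refine Tendsto.const_mul _ (tendsto_integral_filter_of_dominated_convergence
    (fun ξ => K * ‖hatMap N f ξ‖) ?_ ?_ ?_ ?_)
  · filter_upwards [self_mem_nhdsWithin] with ε hε
    exact ((((continuous_exp_I_inner x).mul (hatMap N f).continuous)).mul
      ((continuous_const.sub (hatMap N ψ).continuous).mul
        (continuous_inv_below hε))).aestronglyMeasurable
  · filter_upwards [self_mem_nhdsWithin] with ε hε
    refine Eventually.of_forall fun ξ => ?_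
    rw [norm_mul, norm_mul, norm_exp_I_mul, one_mul, mul_comm K]
    gcongr
    refine le_trans ?_ (hK ξ)
    by_cases hξ : symbol α β V ξ = 0
    · simp [(hatMap_eq_one_of_symbol_eq_zero hc₁ hψ hξ).self_of_nhds]
    · rw [awayMultiplier, norm_mul, norm_mul, norm_inv, norm_inv, Complex.norm_real,
        Real.norm_eq_abs]
      gcongr
      exact abs_le_norm_below _ _
  · exact ((hatMap N f).integrable (μ := volume)).norm.const_mul _
  · refine Eventually.of_forall fun ξ => Tendsto.const_mul _ ?_
    by_cases hξ : symbol α β V ξ = 0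
    · simp [awayMultiplier, (hatMap_eq_one_of_symbol_eq_zero hc₁ hψ hξ).self_of_nhds]
    · exact ((tendsto_below _).inv₀ (by simpa using hξ)).const_mul _

end Convolution

end Helmholtz
namespace Helmholtz

open scoped FourierTransform

/-! ### Domination by Riesz potentials. -/

section RieszBound

variable {N : ℕ} {a : ℝ}

/-- As `1 + ‖ξ‖` exceeds both `1` and `‖ξ‖`, lowering the order from `s` to `a` and then the weight
to `‖ξ‖` only weakens the estimate. One symbol thus admits a whole range of degrees, and `a` can be
tuned to the Lebesgue exponents. -/
theorem IsSymbol.exists_homogeneousBound {s : ℝ} {m : EuclideanSpace ℝ (Fin N) → ℂ}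
    (hm : IsSymbol (-s) m) (ha0 : 0 ≤ a) (ha : a ≤ s) (n : ℕ) :
    ∃ C : ℝ, 0 ≤ C ∧ HomogeneousBound n a C m := by
  obtain ⟨C, hC0, hC⟩ := (hm.2 n).exists_bound hm.1
  refine ⟨C, hC0, fun k hk ξ hξ => (hC k hk ξ).trans ?_⟩
  have hξ' : 0 < ‖ξ‖ := norm_pos_iff.2 hξ
  have hk0 : (0 : ℝ) ≤ k := k.cast_nonneg
  gcongr ?_ * ?_
  calc (1 + ‖ξ‖) ^ (-s - k) ≤ (1 + ‖ξ‖) ^ (-a - k) :=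
        Real.rpow_le_rpow_of_exponent_le (by linarith) (by linarith)
    _ ≤ ‖ξ‖ ^ (-a - k) :=
        Real.rpow_le_rpow_of_nonpos hξ' (by linarith) (by linarith)

/-- The kernel of a Fourier multiplier with homogeneous bounds of degree `-a` is bounded by the
Riesz kernel of order `a`. -/
theorem exists_kernel_le [Nontrivial (EuclideanSpace ℝ (Fin N))] {C : ℝ} (ha0 : 0 < a)
    (haN : a < N) (hC : 0 ≤ C) :
    ∃ K : ℝ, 0 < K ∧ ∀ u : EuclideanSpace ℝ (Fin N) → ℂ, ContDiff ℝ ∞ u → HasCompactSupport u →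
      HomogeneousBound N a C u → ∀ z ≠ 0,
        ‖∫ ξ, Complex.exp (Complex.I * (inner ℝ z ξ : ℝ)) * u ξ‖ ≤ K * ‖z‖ ^ (-(N - a)) := by
  have hN : Module.finrank ℝ (EuclideanSpace ℝ (Fin N)) = N := finrank_euclideanSpace_fin
  obtain ⟨K, hK0, hK⟩ := exists_fourier_le_of_homogeneousBound
    (E := EuclideanSpace ℝ (Fin N)) ha0 (by rwa [hN]) hC
  rw [hN] at hK
  have hπ : 0 < (2 * Real.pi)⁻¹ := by positivity
  refine ⟨(K + 1) * (2 * Real.pi)⁻¹ ^ (-(N - a)), by positivity, fun u hu huc hub z hz => ?_⟩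
  have h1 := hK u hu huc hub (-((2 * Real.pi)⁻¹ • z)) (neg_ne_zero.2 (smul_ne_zero hπ.ne' hz))
  have h2 : 𝓕 u (-((2 * Real.pi)⁻¹ • z)) =
      ∫ ξ, Complex.exp (Complex.I * (inner ℝ z ξ : ℝ)) * u ξ := by
    rw [Real.fourier_eq']
    refine integral_congr_ae (Eventually.of_forall fun ξ => ?_)
    have h3 : -2 * Real.pi * inner ℝ ξ (-((2 * Real.pi)⁻¹ • z)) = inner ℝ z ξ := by
      rw [inner_neg_right, real_inner_smul_right, real_inner_comm]
      field_simp
    simp only [h3, smul_eq_mul]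
    rw [mul_comm Complex.I]
  rw [h2, norm_neg, norm_smul, Real.norm_of_nonneg hπ.le,
    Real.mul_rpow hπ.le (norm_nonneg z)] at h1
  refine h1.trans ?_
  rw [← mul_assoc]
  gcongr
  linarith

/-- Fubini's theorem for a multiplier operator. -/
theorem integral_exp_mul_hatMap_mul {u : EuclideanSpace ℝ (Fin N) → ℂ} (hu : Integrable u)
    (f : 𝓢(EuclideanSpace ℝ (Fin N), ℂ)) (x : EuclideanSpace ℝ (Fin N)) :
    ∫ ξ, Complex.exp (Complex.I * (inner ℝ x ξ : ℝ)) * hatMap N f ξ * u ξ =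
      ∫ y, (∫ ξ, Complex.exp (Complex.I * (inner ℝ (x - y) ξ : ℝ)) * u ξ) * f y := by
  set w : EuclideanSpace ℝ (Fin N) × EuclideanSpace ℝ (Fin N) → ℂ := fun z =>
    Complex.exp (Complex.I * (inner ℝ (x - z.1) z.2 : ℝ)) * (f z.1 * u z.2)
  have hw : Integrable w (volume.prod volume) := by
    refine ((f.integrable (μ := volume)).mul_prod hu).bdd_mul (c := 1) ?_
      (Eventually.of_forall fun z => (norm_exp_I_mul _).le)
    exact Continuous.aestronglyMeasurable (by fun_prop)
  have h1 : ∀ y, (∫ ξ, Complex.exp (Complex.I * (inner ℝ (x - y) ξ : ℝ)) * u ξ) * f y =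
      ∫ ξ, w (y, ξ) := fun y => by
    rw [← integral_mul_const]
    refine integral_congr_ae (Eventually.of_forall fun ξ => ?_)
    simp only [w]
    ring
  simp only [h1]
  rw [integral_integral_swap hw]
  refine integral_congr_ae (Eventually.of_forall fun ξ => ?_)
  simp only [w]
  rw [hatMap_apply, hat, ← integral_const_mul, ← integral_mul_const]
  refine integral_congr_ae (Eventually.of_forall fun y => ?_)
  simp only
  rw [inner_sub_left, ← mul_assoc, ← mul_assoc, ← Complex.exp_add]
  congr 3
  push_cast
  ring

/-- A Fourier multiplier operator whose multiplier is a symbol of order `-s` is dominated by the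
Riesz potentials of all orders `a ≤ s`. -/
theorem IsSymbol.exists_enorm_le_rieszPotential [Nontrivial (EuclideanSpace ℝ (Fin N))] {s : ℝ}
    {m : EuclideanSpace ℝ (Fin N) → ℂ} (hm : IsSymbol (-s) m) (ha0 : 0 < a) (ha : a ≤ s)
    (haN : a < N) :
    ∃ K : ℝ, 0 < K ∧ ∀ (f : 𝓢(EuclideanSpace ℝ (Fin N), ℂ)) (x : EuclideanSpace ℝ (Fin N)),
      ‖∫ ξ, Complex.exp (Complex.I * (inner ℝ x ξ : ℝ)) * hatMap N f ξ * m ξ‖ₑ ≤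
        ENNReal.ofReal K * rieszPotential volume (N - a) (fun y => ‖f y‖ₑ) x := by
  obtain ⟨χ, hχ, hχc, hχ1, hχ_one, -⟩ := exists_bump (EuclideanSpace ℝ (Fin N))
  obtain ⟨D, hD0, hD⟩ := HomogeneousBound.of_hasCompactSupport N hχc hχ
  obtain ⟨C, hC0, hC⟩ := hm.exists_homogeneousBound ha0.le ha N
  obtain ⟨K, hK0, hK⟩ := exists_kernel_le (C := 2 ^ N * (C * D)) ha0 haN (by positivity)
  refine ⟨K, hK0, fun f x => ?_⟩
  -- The multiplier need not be integrable, so it is truncated. Scale invariance of degree-zero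
  -- bounds keeps the kernel constant independent of `n`, and the estimate passes to the limit.
  set u : ℕ → EuclideanSpace ℝ (Fin N) → ℂ := fun n ξ => m ξ * χ (((n : ℝ) + 1)⁻¹ • ξ)
  have hn0 : ∀ n : ℕ, 0 < ((n : ℝ) + 1)⁻¹ := fun n => by positivity
  have hχn : ∀ n : ℕ, ContDiff ℝ ∞ fun ξ => χ (((n : ℝ) + 1)⁻¹ • ξ) := fun n =>
    hχ.comp (contDiff_id.const_smul _)
  have hu : ∀ n, ContDiff ℝ ∞ (u n) := fun n => hm.1.mul (hχn n)
  have huc : ∀ n, HasCompactSupport (u n) := fun n =>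
    (hχc.comp_homeomorph (Homeomorph.smulOfNeZero _ (hn0 n).ne')).mul_left
  have hub : ∀ n, HomogeneousBound N a (2 ^ N * (C * D)) (u n) := fun n => by
    simpa only [add_zero] using hC.mul hC0 (hD.comp_smul hχ (hn0 n)) hm.1 (hχn n)
  obtain ⟨B, hB⟩ : ∃ B : ℝ, ∀ ξ, ‖m ξ‖ ≤ B := by
    obtain ⟨B, -, hB⟩ := ((hm.mono (t := 0) (by linarith)).2 0).exists_bound hm.1
    exact ⟨B, fun ξ => by simpa using hB 0 le_rfl ξ⟩
  have hlim : Tendsto (fun n => ∫ ξ, Complex.exp (Complex.I * (inner ℝ x ξ : ℝ)) *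
      hatMap N f ξ * u n ξ) atTop (𝓝 (∫ ξ, Complex.exp (Complex.I * (inner ℝ x ξ : ℝ)) *
      hatMap N f ξ * m ξ)) := by
    refine tendsto_integral_of_dominated_convergence (fun ξ => ‖hatMap N f ξ‖ * B) (fun n => ?_)
      (((hatMap N f).integrable (μ := volume)).norm.mul_const _)
      (fun n => Eventually.of_forall fun ξ => ?_) (Eventually.of_forall fun ξ => ?_)
    · exact (((continuous_exp_I_inner x).mul (hatMap N f).continuous).mul
        (hu n).continuous).aestronglyMeasurable
    · rw [norm_mul, norm_mul, norm_exp_I_mul, one_mul]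
      gcongr
      rw [norm_mul]
      exact (mul_le_of_le_one_right (norm_nonneg _) (hχ1 _)).trans (hB ξ)
    · refine tendsto_const_nhds.congr' ?_
      filter_upwards [eventually_ge_atTop ⌈‖ξ‖⌉₊] with n hn
      have h1 : ‖((n : ℝ) + 1)⁻¹ • ξ‖ ≤ 1 := by
        rw [norm_smul, Real.norm_of_nonneg (hn0 n).le, inv_mul_le_one₀ (by positivity)]
        linarith [Nat.ceil_le.1 hn]
      simp only [u, hχ_one _ h1, mul_one]
  refine le_of_tendsto hlim.enorm (Eventually.of_forall fun n => ?_)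
  rw [integral_exp_mul_hatMap_mul ((hu n).continuous.integrable_of_hasCompactSupport (huc n)),
    rieszPotential, ← lintegral_const_mul' _ _ ENNReal.ofReal_ne_top]
  refine (enorm_integral_le_lintegral_enorm _).trans (lintegral_mono_ae ?_)
  -- The kernel bound is only available off the diagonal, which is a null set in `y`.
  filter_upwards [compl_mem_ae_iff.2 (measure_singleton x)] with y hy
  rw [enorm_mul, ← mul_assoc, ← ENNReal.ofReal_mul hK0.le]
  gcongr
  rw [← ofReal_norm]
  refine ENNReal.ofReal_le_ofReal (hK (u n) (hu n) (huc n) (hub n) _ (sub_ne_zero.2 ?_))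
  exact fun h => hy h.symm

end RieszBound

/-! ### Lebesgue bounds and extension by density. -/

section LebesgueBound

variable {N : ℕ} {α β : ℝ} {V : EuclideanSpace ℝ (Fin N)} {c₁ : ℝ}
  {ψ : 𝓢(EuclideanSpace ℝ (Fin N), ℂ)} {p q : ℝ}

/-- The order `a = N(1/p - 1/q)` is the one for which the Riesz kernel `|x|^(-(N - a))` maps `Lᵖ` to
`Lᵠ`; it must satisfy `0 < a ≤ 4` and `a < N`. -/
theorem exists_eLpNorm_awayOperator_le [Nontrivial (EuclideanSpace ℝ (Fin N))] (hc₁ : 0 < c₁)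
    (hψ : IsCutoff α β V c₁ ψ) (hp : 1 < p) (hpq : p < q) (h4 : N * (1 / p - 1 / q) ≤ 4) :
    ∃ C : ℝ, 0 ≤ C ∧ ∀ f : 𝓢(EuclideanSpace ℝ (Fin N), ℂ),
      eLpNorm (awayOperator α β V ψ f) (ENNReal.ofReal q) volume ≤
        ENNReal.ofReal C * eLpNorm f (ENNReal.ofReal p) volume := by
  have hN : Module.finrank ℝ (EuclideanSpace ℝ (Fin N)) = N := finrank_euclideanSpace_fin
  have hN0 : (0 : ℝ) < N := by
    rw [← hN]
    exact_mod_cast Module.finrank_pos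
  have h1 : 0 < 1 / p - 1 / q := sub_pos.2 (one_div_lt_one_div_of_lt (by linarith) hpq)
  have h2 : 1 / p - 1 / q < 1 := by
    have h3 : 1 / p < 1 := (div_lt_one (by linarith)).2 hp
    have h5 : 0 < 1 / q := one_div_pos.2 (by linarith)
    linarith
  set a := N * (1 / p - 1 / q) with ha
  have ha0 : 0 < a := by positivity
  have haN : a < N := by nlinarith
  obtain ⟨K, hK0, hK⟩ := (isSymbol_awayMultiplier hc₁ hψ).exists_enorm_le_rieszPotential ha0 h4 haN
  obtain ⟨C, hC0, hC⟩ := exists_eLpNorm_le_of_le_rieszPotential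
    (μ := (volume : Measure (EuclideanSpace ℝ (Fin N)))) (b := N - a) (by linarith)
    (by rw [hN]; linarith) hp hpq (by
      rw [hN, sub_div, div_self hN0.ne', ha, mul_div_cancel_left₀ _ hN0.ne', sub_sub_cancel])
  set L : ℝ := ((2 * Real.pi) ^ N : ℝ)⁻¹ with hL
  have hL0 : 0 < L := by positivity
  refine ⟨C * (L * K), by positivity, fun f => ?_⟩
  -- The Hardy–Littlewood–Sobolev lemma asks for domination with constant one, so the constants are
  -- absorbed into the input function.
  have hg : ((fun x => ((L * K : ℝ) : ℂ) * f x) : EuclideanSpace ℝ (Fin N) → ℂ) =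
      ((L * K : ℝ) : ℂ) • ⇑f := rfl
  have hnorm : ‖((L * K : ℝ) : ℂ)‖ₑ = ENNReal.ofReal (L * K) := by
    rw [← ofReal_norm, Complex.norm_real, Real.norm_of_nonneg (by positivity)]
  have hgp : eLpNorm (((L * K : ℝ) : ℂ) • ⇑f) (ENNReal.ofReal p) volume =
      ENNReal.ofReal (L * K) * eLpNorm f (ENNReal.ofReal p) volume := by
    rw [eLpNorm_const_smul, hnorm]
  have h := hC (fun x => ((L * K : ℝ) : ℂ) * f x) (awayOperator α β V ψ f)
    (continuous_const.mul f.continuous).measurable (awayOperator α β V ψ f).continuous.measurable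
    (by rw [hg, hgp]; exact ENNReal.mul_lt_top ENNReal.ofReal_lt_top (f.memLp _ volume).2) ?_
  · rwa [hg, hgp, ← mul_assoc, ← ENNReal.ofReal_mul hC0] at h
  · intro x
    rw [awayOperator_apply hc₁ hψ, enorm_mul]
    have hLn : ‖(L : ℂ)‖ₑ = ENNReal.ofReal L := by
      rw [← ofReal_norm, Complex.norm_real, Real.norm_of_nonneg hL0.le]
    rw [hLn]
    calc ENNReal.ofReal L * _
        ≤ ENNReal.ofReal L * (ENNReal.ofReal K *
          rieszPotential volume (N - a) (fun y => ‖f y‖ₑ) x) := by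
          gcongr
          exact hK f x
      _ = rieszPotential volume (N - a) (fun y => ‖((L * K : ℝ) : ℂ) * f y‖ₑ) x := by
          rw [← mul_assoc, ← ENNReal.ofReal_mul hL0.le, rieszPotential, rieszPotential,
            ← lintegral_const_mul' _ _ ENNReal.ofReal_ne_top]
          refine lintegral_congr fun y => ?_
          rw [enorm_mul, hnorm]
          ring

/-- Schwartz functions are dense in `Lᵖ` for `p < ∞`, so the a priori estimate extends the operator
by continuity. -/
theorem exists_linearMap_extending_awayOperator [Nontrivial (EuclideanSpace ℝ (Fin N))]
    (hc₁ : 0 < c₁) (hψ : IsCutoff α β V c₁ ψ) (hp : 1 < p) (hpq : p < q)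
    (h4 : N * (1 / p - 1 / q) ≤ 4) :
    ∃ T : Lp ℂ (ENNReal.ofReal p) (volume : Measure (EuclideanSpace ℝ (Fin N))) →ₗ[ℂ]
        Lp ℂ (ENNReal.ofReal q) (volume : Measure (EuclideanSpace ℝ (Fin N))),
      (∀ f : 𝓢(EuclideanSpace ℝ (Fin N), ℂ), T (f.toLp (ENNReal.ofReal p) volume) =
        (awayOperator α β V ψ f).toLp (ENNReal.ofReal q) volume) ∧
      ∃ C : ℝ, ∀ f : Lp ℂ (ENNReal.ofReal p) (volume : Measure (EuclideanSpace ℝ (Fin N))),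
        ‖T f‖ ≤ C * ‖f‖ := by
  have : Fact (1 ≤ ENNReal.ofReal p) := ⟨by rw [← ENNReal.ofReal_one]; gcongr⟩
  have : Fact (1 ≤ ENNReal.ofReal q) := ⟨by rw [← ENNReal.ofReal_one]; gcongr; linarith⟩
  obtain ⟨C, hC0, hC⟩ := exists_eLpNorm_awayOperator_le hc₁ hψ hp hpq h4
  set R : 𝓢(EuclideanSpace ℝ (Fin N), ℂ) →ₗ[ℂ]
      Lp ℂ (ENNReal.ofReal q) (volume : Measure (EuclideanSpace ℝ (Fin N))) :=
    (SchwartzMap.toLpCLM ℂ ℂ (ENNReal.ofReal q) volume ∘L awayOperator α β V ψ).toLinearMap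
  set e : 𝓢(EuclideanSpace ℝ (Fin N), ℂ) →ₗ[ℂ]
      Lp ℂ (ENNReal.ofReal p) (volume : Measure (EuclideanSpace ℝ (Fin N))) :=
    (SchwartzMap.toLpCLM ℂ ℂ (ENNReal.ofReal p) volume).toLinearMap
  have hdense : DenseRange e := SchwartzMap.denseRange_toLpCLM ENNReal.ofReal_ne_top
  have hbound : ∀ f, ‖R f‖ ≤ C * ‖e f‖ := fun f => by
    change ‖(awayOperator α β V ψ f).toLp (ENNReal.ofReal q) volume‖ ≤
      C * ‖f.toLp (ENNReal.ofReal p) volume‖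
    rw [SchwartzMap.norm_toLp, SchwartzMap.norm_toLp, ← ENNReal.toReal_ofReal hC0,
      ← ENNReal.toReal_mul]
    exact ENNReal.toReal_mono
      (ENNReal.mul_ne_top ENNReal.ofReal_ne_top (f.memLp _ volume).2.ne) (hC f)
  exact ⟨(R.extendOfNorm e).toLinearMap,
    fun f => LinearMap.extendOfNorm_eq hdense ⟨C, hbound⟩ f,
    C, LinearMap.norm_extendOfNorm_apply_le hdense C hbound⟩

end LebesgueBound

end Helmholtz
theorem proposition3p3 (N : ℕ) (hN : 2 ≤ N) (α β : ℝ) (V : EuclideanSpace ℝ (Fin N))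
    (hA1 : Helmholtz.CondA1 α β V) (hA2 : Helmholtz.CondA2 α β V)
    (hA3 : Helmholtz.CondA3 α β V) :
    (∃ G : 𝓢'(EuclideanSpace ℝ (Fin N), ℂ), Helmholtz.IsGreenFunction α β V G) ∧
    ∀ G : 𝓢'(EuclideanSpace ℝ (Fin N), ℂ), Helmholtz.IsGreenFunction α β V G →
    ∀ c₁ : ℝ, 0 < c₁ →
    ∀ ψ : 𝓢(EuclideanSpace ℝ (Fin N), ℂ), Helmholtz.IsCutoff α β V c₁ ψ →
    ∀ p q : ℝ, 1 < p → p < q →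
      (N < 4 → 1 / p - 1 / q ≤ 1) →
      (N = 4 → 1 / p - 1 / q < 1) →
      (4 < N → 1 / p - 1 / q ≤ 4 / (N : ℝ)) →
      ∃ T : Lp ℂ (ENNReal.ofReal p) (volume : Measure (EuclideanSpace ℝ (Fin N))) →ₗ[ℂ]
          Lp ℂ (ENNReal.ofReal q) (volume : Measure (EuclideanSpace ℝ (Fin N))),
        (∀ f : 𝓢(EuclideanSpace ℝ (Fin N), ℂ),
          T (f.toLp (ENNReal.ofReal p) volume) =ᵐ[volume] Helmholtz.resolventAway G ψ f) ∧
        ∃ C : ℝ, ∀ f : Lp ℂ (ENNReal.ofReal p) (volume : Measure (EuclideanSpace ℝ (Fin N))),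
          ‖T f‖ ≤ C * ‖f‖ := by
  refine ⟨Helmholtz.exists_isGreenFunction hA2, fun G hG c₁ hc₁ ψ hψ p q hp hpq h₁ h₂ h₃ => ?_⟩
  have : Nontrivial (EuclideanSpace ℝ (Fin N)) :=
    Module.nontrivial_of_finrank_pos (R := ℝ) (by rw [finrank_euclideanSpace_fin]; omega)
  have hN0 : (0 : ℝ) < N := by exact_mod_cast (by omega : 0 < N)
  -- The three dimensional cases collapse to one inequality: for `N ≤ 4` it follows from `1/p - 1/q
  -- ≤ 1`, and for `N > 4` it is the assumption itself.
  have h4 : N * (1 / p - 1 / q) ≤ 4 := by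
    rcases lt_trichotomy N 4 with h | h | h
    · have hN4 : (N : ℝ) ≤ 4 := by exact_mod_cast h.le
      exact (mul_le_of_le_one_right hN0.le (h₁ h)).trans hN4
    · have hN4 : (N : ℝ) ≤ 4 := by exact_mod_cast h.le
      exact (mul_le_of_le_one_right hN0.le (h₂ h).le).trans hN4
    · exact (le_div_iff₀' hN0).1 (h₃ h)
  obtain ⟨T, hT, hb⟩ := Helmholtz.exists_linearMap_extending_awayOperator hc₁ hψ hp hpq h4
  refine ⟨T, fun f => ?_, hb⟩
  rw [hT]
  filter_upwards [(Helmholtz.awayOperator α β V ψ f).coeFn_toLp (ENNReal.ofReal q) volume] with x hx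
  rw [hx, Helmholtz.resolventAway_eq hA2 hG hc₁ hψ]
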